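/- Let $L$ be a smooth, simply connected, oriented manifold of dimension $l$, let $\overline p$ be an extended perversity, i.e. an arbitrary sequence of integers, and put $k = l-\overline p(l+1)\in\mathbb Z$. All homology is singular homology with real coefficients; it is zero in negative degrees, and $\widetilde H$ denotes reduced homology. Let $f\colon L_{<k}\to L$ be a stage $k$ Moore approximation of $L$, i.e. a continuous map such that $f_*\colon H_i(L_{<k})\to H_i(L)$ is an isomorphism for $i<k$ and $H_i(L_{<k})=0$ for $i\ge k$. Let $X={\rm susp}(L)$ be the quotient of $L\times[-1,1]$ obtained by collapsing $L\times\{1\}$ to a point $v$ and $L\times\{-1\}$ to a point $u$, with singular set $\Sigma=\{u,v\}$ and its standard tube $N\setminus\Sigma\cong L\times\Sigma\times(0,1)$, under which $(y,v,t)$ corresponds to $[y,1-t]$ and $(y,u,t)$ to $[y,-(1-t)]$. Let $\overline M=(X\setminus\Sigma)\cup (L\times\Sigma\times[0,1))$ be the blow-up, glued along $N\setminus\Sigma$ (so $\overline M\cong L\times[-1,1]$), and let $I^{\overline p}X=\overline M\cup_g c(L_{<k}\times\Sigma)$ be the intersection space, i.e. the mapping cone of the composition $$g\colon L_{<k}\times\Sigma\xrightarrow{\,f\times{\rm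 id}\,}L\times\Sigma=\partial\overline M\hookrightarrow\overline M ,$$ where the cone $c(Y)=(Y\times[0,1])/(Y\times\{1\})$ is empty for $Y=\emptyset$. Then, for every integer $j$, the group $\widetilde{H}I^{\overline p}_j(X)=\widetilde H_j(I^{\overline p}X)$ satisfies $$\widetilde{H}I^{\overline p}_j\bigl({\rm susp}(L)\bigr)\cong\begin{cases} H_{j-1}(L), & 0<j<k,\\ \widetilde H_j(L)\oplus H_{j-1}(L), & j=k,\\ \widetilde H_j(L), & \text{otherwise.}\end{cases}$$ (The group $H_{j-1}(L)$ is unreduced; it agrees with $\widetilde H_{j-1}(L)$ except in degree $j=1$, where it is $H_0(L)=\mathbb R$.) -/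

import Mathlib

open CategoryTheory Set
open scoped Manifold ContDiff

universe u

namespace HISusp

noncomputable section

/-! ### Real singular homology -/

/-- The `n`-th singular homology functor with real coefficients, for every integer `n`
(zero for negative `n`). -/
def homology : ℤ → TopCat.{u} ⥤ ModuleCat.{u} ℝ
  | Int.ofNat n => (AlgebraicTopology.singularHomologyFunctor (ModuleCat.{u} ℝ) n).obj
      (ModuleCat.of ℝ (ULift.{u} ℝ))
  | Int.negSucc _ => (Functor.const _).obj (ModuleCat.of ℝ PUnit.{u + 1})

/-- The real singular homology `H_n(X; ℝ)` of a space `X`. -/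
abbrev H (n : ℤ) (X : Type u) [TopologicalSpace X] : Type u :=
  (homology n).obj (TopCat.of X)

/-- The map `H_n(X; ℝ) → H_n(Y; ℝ)` induced by a continuous map. -/
def H.map (n : ℤ) {X Y : Type u} [TopologicalSpace X] [TopologicalSpace Y] (f : C(X, Y)) :
    H n X →ₗ[ℝ] H n Y :=
  ((homology n).map (TopCat.ofHom f)).hom

/-- The reduced homology of a (non-empty) space `X`: the kernel of `H_n(X; ℝ) → H_n(pt; ℝ)`. -/
abbrev reducedH (n : ℤ) (X : Type u) [TopologicalSpace X] : Type u :=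
  LinearMap.ker (H.map n (ContinuousMap.const X PUnit.unit : C(X, PUnit.{u + 1})))

/-! ### Orientations -/

/-- An orientation of a smooth `l`-manifold, given by an oriented atlas: smooth charts that
cover `L` and whose changes of coordinates have positive Jacobian determinant. -/
structure OrientedAtlas (l : ℕ) (L : Type u) [TopologicalSpace L]
    [ChartedSpace (EuclideanSpace ℝ (Fin l)) L] where
  /-- The positively oriented charts. -/
  charts : Set (OpenPartialHomeomorph L (EuclideanSpace ℝ (Fin l)))
  smooth : charts ⊆ IsManifold.maximalAtlas (𝓡 l) ∞ L
  covers : ∀ x : L, ∃ φ ∈ charts, x ∈ φ.source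
  det_pos : ∀ φ ∈ charts, ∀ ψ ∈ charts, ∀ y ∈ (φ.symm.trans ψ).source,
    0 < (fderiv ℝ (φ.symm.trans ψ) y).det

/-! ### Cones and mapping cones -/

/-- Two points of `Y × [0,1]` that are identified in the cone. -/
def ConeRel (Y : Type u) (a b : Y × Icc (0 : ℝ) 1) : Prop := a.2 = 1 ∧ b.2 = 1

/-- The closed cone `c(Y)`: the cylinder `Y × [0,1]` with `Y × {1}` collapsed. -/
def Cone (Y : Type u) : Type u := Quot (ConeRel Y)

instance (Y : Type u) [TopologicalSpace Y] : TopologicalSpace (Cone Y) :=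
  inferInstanceAs (TopologicalSpace (Quot (ConeRel Y)))

/-- The inclusion of the base, `y ↦ [y, 0]`, into the cone. -/
def Cone.base {Y : Type u} (y : Y) : Cone Y := Quot.mk _ (y, 0)

/-- The gluing relation of the mapping cone. -/
def MappingConeRel {W M : Type u} (g : W → M) (a b : M ⊕ Cone W) : Prop :=
  ∃ w : W, a = Sum.inl (g w) ∧ b = Sum.inr (Cone.base w)

/-- The mapping cone `cone(g) = M ∪_g c(W)`. -/
def MappingCone {W M : Type u} (g : W → M) : Type u := Quot (MappingConeRel g)

instance {W M : Type u} [TopologicalSpace W] [TopologicalSpace M] (g : W → M) :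
    TopologicalSpace (MappingCone g) :=
  inferInstanceAs (TopologicalSpace (Quot (MappingConeRel g)))

/-! ### Intersection spaces -/

/-- A space `X` with a closed singular set `S`, together with control data `(proj, dist)` on a
tubular neighbourhood `N = S ∪ range e` of `S` and a trivialization
`e = θ⁻¹ : L × S × (0,1) ≅ N \ S` with link `L`, compatible with the control data. -/
structure TrivialTube (L X : Type u) [TopologicalSpace L] [TopologicalSpace X] (S : Set X) where
  isClosed : IsClosed S
  /-- The inverse of the trivialization `θ : N \ S ≅ L × S × (0,1)`. -/
  e : L × S × Ioo (0 : ℝ) 1 → X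
  isOpenEmbedding : Topology.IsOpenEmbedding e
  not_mem : ∀ a, e a ∈ Sᶜ
  isOpen_nhd : IsOpen (S ∪ range e)
  /-- The retraction of `N` onto `S` (its values off `N` are irrelevant). -/
  proj : X → S
  /-- The distance function on `N` (its values off `N` are irrelevant). -/
  dist : X → ℝ
  proj_continuousOn : ContinuousOn proj (S ∪ range e)
  dist_continuousOn : ContinuousOn dist (S ∪ range e)
  proj_self : ∀ s : S, proj s = s
  dist_self : ∀ s : S, dist s = 0
  proj_e : ∀ a, proj (e a) = a.2.1
  dist_e : ∀ a, dist (e a) = a.2.2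

section BlowUp

variable {L X : Type u} [TopologicalSpace L] [TopologicalSpace X] {S : Set X}

/-- The gluing relation of the blow-up: `e (y, s, t) ∈ X \ S` is glued to
`(y, s, t) ∈ L × S × [0,1)` for `0 < t < 1`. -/
def BlowUpRel (T : TrivialTube L X S) (a b : (Sᶜ : Set X) ⊕ (L × S × Ico (0 : ℝ) 1)) : Prop :=
  ∃ c : L × S × Ioo (0 : ℝ) 1, a = Sum.inl ⟨T.e c, T.not_mem c⟩ ∧
    b = Sum.inr (c.1, c.2.1, ⟨c.2.2, Ioo_subset_Ico_self c.2.2.2⟩)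

/-- The blow-up `(X \ S) ∪_θ (L × S × [0,1))`. -/
def BlowUp (T : TrivialTube L X S) : Type u := Quot (BlowUpRel T)

instance (T : TrivialTube L X S) : TopologicalSpace (BlowUp T) :=
  inferInstanceAs (TopologicalSpace (Quot (BlowUpRel T)))

/-- The inclusion `L × S → L × S × [0,1) → BlowUp T`, `(y, s) ↦ [y, s, 0]`, of the boundary. -/
def BlowUp.boundary (T : TrivialTube L X S) (a : L × S) : BlowUp T :=
  Quot.mk _ (Sum.inr (a.1, a.2, ⟨0, le_refl _, zero_lt_one⟩))

end BlowUp

/-- A stage-`k` Moore approximation of `L`: a space `L_{<k}` with a continuous map `f` to `L`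
which is an isomorphism on `H_i` for `i < k`, while `H_i(L_{<k}) = 0` for `i ≥ k`. -/
structure MooreApproximation (k : ℤ) (L : Type u) [TopologicalSpace L] where
  /-- The space `L_{<k}`. -/
  space : Type u
  [top : TopologicalSpace space]
  /-- The structure map `f : L_{<k} → L`. -/
  map : C(space, L)
  bijective : ∀ i : ℤ, i < k → Function.Bijective (H.map i map)
  vanishing : ∀ i : ℤ, k ≤ i → Subsingleton (H i space)

attribute [instance] MooreApproximation.top

/-- An extended perversity: a sequence of integers. -/
abbrev ExtendedPerversity : Type := ℕ → ℤ

/-- The cut-off degree `k = l - p(l + 1)` of an `l`-dimensional link. -/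
def cutoff (p : ExtendedPerversity) (l : ℕ) : ℤ := (l : ℤ) - p (l + 1)

/-- The perversity `p` intersection space `I^p X = cone(g)` of a space with trivialized tube
around its singular set `S`, whose link `L` has dimension `l`, relative to a Moore approximation
`f : L_{<k} → L` with `k = l - p(l + 1)`. Here `g` is the composition
`L_{<k} × S → L × S → BlowUp T` of `f × id` with the inclusion of the boundary. -/
abbrev IntersectionSpace (p : ExtendedPerversity) (l : ℕ) {L X : Type u} [TopologicalSpace L]
    [TopologicalSpace X] {S : Set X} (T : TrivialTube L X S)
    (A : MooreApproximation (cutoff p l) L) : Type u :=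
  MappingCone fun a : A.space × S => BlowUp.boundary T (A.map a.1, a.2)

/-- The reduced homology `H̃_j(I^p X; ℝ)` of the intersection space. -/
abbrev reducedHI (p : ExtendedPerversity) (l : ℕ) (j : ℤ) {L X : Type u} [TopologicalSpace L]
    [TopologicalSpace X] {S : Set X} (T : TrivialTube L X S)
    (A : MooreApproximation (cutoff p l) L) : Type u :=
  reducedH j (IntersectionSpace p l T A)

/-! ### The suspension -/

/-- Collapse `L × {1}` to a point and `L × {-1}` to another point. -/
def suspSetoid (L : Type u) : Setoid (L × Icc (-1 : ℝ) 1) where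
  r a b := a = b ∨ (a.2.1 = 1 ∧ b.2.1 = 1) ∨ (a.2.1 = -1 ∧ b.2.1 = -1)
  iseqv := by
    refine ⟨fun a => Or.inl rfl, ?_, ?_⟩
    · rintro a b (h | h | h)
      · exact Or.inl h.symm
      · exact Or.inr (Or.inl h.symm)
      · exact Or.inr (Or.inr h.symm)
    · rintro a b c (rfl | h | h) (rfl | h' | h')
      · exact Or.inl rfl
      · exact Or.inr (Or.inl h')
      · exact Or.inr (Or.inr h')
      · exact Or.inr (Or.inl h)
      · exact Or.inr (Or.inl ⟨h.1, h'.2⟩)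
      · exact absurd (h.2.symm.trans h'.1) (by norm_num)
      · exact Or.inr (Or.inr h)
      · exact absurd (h.2.symm.trans h'.1) (by norm_num)
      · exact Or.inr (Or.inr ⟨h.1, h'.2⟩)

/-- The suspension of `L`. -/
def Susp (L : Type u) : Type u := Quotient (suspSetoid L)

instance (L : Type u) [TopologicalSpace L] : TopologicalSpace (Susp L) :=
  inferInstanceAs (TopologicalSpace (Quotient (suspSetoid L)))

namespace Susp

variable {L : Type u}

/-- The quotient map `L × [-1,1] → susp(L)`. -/
def mk (y : L) (t : Icc (-1 : ℝ) 1) : Susp L := Quotient.mk (suspSetoid L) (y, t)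

/-- The height function `susp(L) → [-1,1]`, `[y, t] ↦ t`. -/
def height : Susp L → ℝ :=
  Quotient.lift (fun a : L × Icc (-1 : ℝ) 1 => (a.2 : ℝ)) (by
    rintro a b (rfl | h | h)
    · rfl
    · exact h.1.trans h.2.symm
    · exact h.1.trans h.2.symm)

/-- The set of the two cone points of the suspension. -/
def poles (L : Type u) : Set (Susp L) := {x | height x = 1 ∨ height x = -1}

theorem ind {P : Susp L → Prop} (h : ∀ y t, P (mk y t)) (x : Susp L) : P x :=
  Quotient.ind (fun a => h a.1 a.2) x

@[simp] theorem height_mk (y : L) (t : Icc (-1 : ℝ) 1) : height (mk y t) = t := rfl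

theorem mk_eq_mk {y y' : L} {t t' : Icc (-1 : ℝ) 1} : mk y t = mk y' t' ↔
    (y, t) = (y', t') ∨ (t.1 = 1 ∧ t'.1 = 1) ∨ (t.1 = -1 ∧ t'.1 = -1) :=
  ⟨fun h => Quotient.exact h, fun h => Quotient.sound h⟩

theorem pole_ext {s s' : poles L} (h : height s.1 = height s'.1) : s = s' := by
  obtain ⟨x, hx⟩ := s
  obtain ⟨x', hx'⟩ := s'
  induction x using ind with | h y t =>
  induction x' using ind with | h y' t' =>
  simp only [height_mk, poles, mem_ofPred_eq] at h hx hx'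
  apply Subtype.ext
  refine mk_eq_mk.2 ?_
  rcases hx with hx | hx
  · exact Or.inr (Or.inl ⟨hx, h.symm.trans hx⟩)
  · exact Or.inr (Or.inr ⟨hx, h.symm.trans hx⟩)

/-- The pole `[y, 1]` (if `t ≥ 0`) or `[y, -1]` (if `t < 0`) attached to the point `[y, t]`. -/
def side : Susp L → poles L :=
  Quotient.lift (fun a : L × Icc (-1 : ℝ) 1 =>
    if 0 ≤ (a.2 : ℝ) then (⟨mk a.1 ⟨1, by norm_num⟩, Or.inl rfl⟩ : poles L)
      else ⟨mk a.1 ⟨-1, by norm_num⟩, Or.inr rfl⟩) (by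
    rintro a b (rfl | h | h)
    · rfl
    · simp only [h.1, h.2, zero_le_one, if_true]
      exact pole_ext rfl
    · have : ¬ (0 : ℝ) ≤ -1 := by norm_num
      simp only [h.1, h.2, this, if_false]
      exact pole_ext rfl)

theorem height_side (x : Susp L) : height (side x).1 = if 0 ≤ height x then 1 else -1 := by
  induction x using ind with | h y t =>
  change height (Subtype.val (if 0 ≤ (t : ℝ) then _ else _)) = if 0 ≤ (t : ℝ) then 1 else -1
  split_ifs <;> rfl

/-- The point `[y, ±(1 - t)]` of the tube, with the sign of the pole `s`. -/
def tube (a : L × poles L × Ioo (0 : ℝ) 1) : Susp L :=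
  mk a.1 ⟨height a.2.1.1 * (1 - a.2.2.1), by
    obtain ⟨y, ⟨s, hs⟩, t, h0, h1⟩ := a
    rcases hs with hs | hs <;> simp only [hs] <;> constructor <;> linarith⟩

theorem height_tube (a : L × poles L × Ioo (0 : ℝ) 1) :
    height (tube a) = height a.2.1.1 * (1 - a.2.2.1) := rfl

theorem range_tube : poles L ∪ range tube = {x : Susp L | height x ≠ 0} := by
  ext x
  constructor
  · rintro (h | ⟨⟨y, ⟨s, hs⟩, t, h0, h1⟩, rfl⟩)
    · rcases h with h | h <;> simp [h]
    · have h2 : 1 - t ≠ 0 := by linarith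
      have h3 : t - 1 ≠ 0 := by linarith
      rcases hs with hs | hs <;> simp [height_tube, hs, h2, h3]
  · intro hx
    by_cases hp : x ∈ poles L
    · exact Or.inl hp
    refine Or.inr ?_
    have hs := height_side x
    induction x using ind with | h y t =>
    obtain ⟨t, h0, h1⟩ := t
    simp only [height_mk, mem_ofPred_eq, poles, not_or] at hx hp hs
    have h0' : -1 < t := lt_of_le_of_ne h0 (Ne.symm hp.2)
    have h1' : t < 1 := lt_of_le_of_ne h1 hp.1
    by_cases ht : 0 ≤ t
    · have ht' : 0 < t := lt_of_le_of_ne ht (Ne.symm hx)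
      refine ⟨(y, side (mk y ⟨t, h0, h1⟩), ⟨1 - t, by linarith, by linarith⟩), ?_⟩
      refine mk_eq_mk.2 (Or.inl ?_)
      simp [hs, ht]
    · refine ⟨(y, side (mk y ⟨t, h0, h1⟩), ⟨1 + t, by linarith, by linarith⟩), ?_⟩
      refine mk_eq_mk.2 (Or.inl ?_)
      simp [hs, ht]

theorem abs_height_tube (a : L × poles L × Ioo (0 : ℝ) 1) :
    |height (tube a)| = 1 - a.2.2.1 := by
  obtain ⟨y, ⟨s, hs⟩, t, h0, h1⟩ := a
  have h2 : |1 - t| = 1 - t := abs_of_pos (by linarith)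
  have h3 : |t - 1| = 1 - t := by rw [abs_sub_comm, h2]
  rcases hs with hs | hs <;> simp [height_tube, hs, h2, h3]

theorem side_tube (a : L × poles L × Ioo (0 : ℝ) 1) : side (tube a) = a.2.1 := by
  apply pole_ext
  rw [height_side, height_tube]
  obtain ⟨y, ⟨s, hs⟩, t, h0, h1⟩ := a
  rcases hs with hs | hs
  · simp [hs, h1.le]
  · have : ¬ (1 : ℝ) ≤ t := by linarith
    simp [hs, this]

theorem side_pole (s : poles L) : side s.1 = s := by
  apply pole_ext
  rw [height_side]
  rcases s.2 with hs | hs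
  · simp [hs]
  · have : ¬ (0 : ℝ) ≤ -1 := by norm_num
    simp [hs, this]

theorem tube_not_mem (a : L × poles L × Ioo (0 : ℝ) 1) : tube a ∈ (poles L)ᶜ := by
  intro h
  have h1 : |height (tube a)| = 1 := by rcases h with h | h <;> simp [h]
  rw [abs_height_tube] at h1
  linarith [a.2.2.2.1]

theorem tube_injective : Function.Injective (tube (L := L)) := by
  intro a b hab
  have h1 : a.2.1 = b.2.1 := by rw [← side_tube a, ← side_tube b, hab]
  have h2 : a.2.2 = b.2.2 := by
    have := abs_height_tube a
    rw [hab, abs_height_tube] at this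
    exact Subtype.ext (by linarith)
  have h3 : a.1 = b.1 := by
    rcases mk_eq_mk.1 hab with h | h | h
    · exact (Prod.ext_iff.1 h).1
    · exact absurd (Or.inl h.1) (tube_not_mem a)
    · exact absurd (Or.inr h.1) (tube_not_mem a)
  exact Prod.ext h3 (Prod.ext h1 h2)

section Topology

variable [TopologicalSpace L]

theorem continuous_mk : Continuous fun a : L × Icc (-1 : ℝ) 1 => mk a.1 a.2 :=
  continuous_quotient_mk'

theorem continuous_height : Continuous (height (L := L)) :=
  Continuous.quotient_lift (continuous_subtype_val.comp continuous_snd) _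

theorem isClosed_poles : IsClosed (poles L) :=
  (isClosed_eq continuous_height continuous_const).union
    (isClosed_eq continuous_height continuous_const)

theorem continuous_tube : Continuous (tube (L := L)) := by
  have hh := continuous_height (L := L)
  refine continuous_mk.comp (Continuous.prodMk continuous_fst (Continuous.subtype_mk ?_ _))
  fun_prop

theorem isOpenMap_tube : IsOpenMap (tube (L := L)) := by
  intro V hV
  have key : tube '' V = ⋃ s : poles L, tube '' (V ∩ {a | a.2.1 = s}) := by
    ext x
    simp only [mem_image, mem_iUnion]
    constructor
    · rintro ⟨a, ha, rfl⟩
      exact ⟨a.2.1, a, ⟨ha, rfl⟩, rfl⟩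
    · rintro ⟨s, a, ha, rfl⟩
      exact ⟨a, ha.1, rfl⟩
  rw [key]
  refine isOpen_iUnion fun s => ?_
  -- the slice of `V` over the pole `s`, viewed in `L × ℝ`
  let W : Set (L × ℝ) := (Prod.map id (Subtype.val : Ioo (0 : ℝ) 1 → ℝ)) ''
    ((fun a : L × Ioo (0 : ℝ) 1 => (a.1, s, a.2)) ⁻¹' V)
  have hW : IsOpen W := by
    refine (IsOpenMap.id.prodMap isOpen_Ioo.isOpenMap_subtype_val) _ (hV.preimage ?_)
    fun_prop
  have hσ : height s.1 * height s.1 = 1 := by rcases s.2 with h | h <;> simp [h]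
  refine (isOpen_coinduced (f := fun a : L × Icc (-1 : ℝ) 1 => mk a.1 a.2)).2 ?_
  have : (fun a : L × Icc (-1 : ℝ) 1 => mk a.1 a.2) ⁻¹' (tube '' (V ∩ {a | a.2.1 = s})) =
      (fun a : L × Icc (-1 : ℝ) 1 => (a.1, 1 - height s.1 * a.2.1)) ⁻¹' W := by
    ext ⟨y, t⟩
    constructor
    · rintro ⟨⟨y', s', t'⟩, ⟨hV', rfl⟩, hc⟩
      have hy : (y', height s'.1 * (1 - t'.1)) = (y, t.1) := by
        rcases mk_eq_mk.1 hc with h | h | h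
        · exact Prod.ext (Prod.ext_iff.1 h).1 (congrArg Subtype.val (Prod.ext_iff.1 h).2)
        · exact absurd (Or.inl h.1) (tube_not_mem (y', s', t'))
        · exact absurd (Or.inr h.1) (tube_not_mem (y', s', t'))
      obtain ⟨rfl, ht⟩ := Prod.mk.injEq _ _ _ _ ▸ hy
      refine ⟨(y', t'), hV', Prod.ext rfl ?_⟩
      change t'.1 = 1 - height s'.1 * t.1
      rw [← ht]
      linear_combination (1 - t'.1) * hσ
    · rintro ⟨⟨y', t'⟩, hV', hc⟩
      obtain ⟨rfl, ht⟩ := Prod.mk.injEq _ _ _ _ ▸ hc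
      refine ⟨(y', s, t'), ⟨hV', rfl⟩, mk_eq_mk.2 (Or.inl (Prod.ext rfl (Subtype.ext ?_)))⟩
      change height s.1 * (1 - t'.1) = t.1
      change t'.1 = 1 - height s.1 * t.1 at ht
      rw [ht]
      linear_combination t.1 * hσ
  rw [this]
  exact hW.preimage (by fun_prop)

theorem continuousOn_side : ContinuousOn (side (L := L)) {x | height x ≠ 0} := by
  intro x hx
  refine ContinuousAt.continuousWithinAt ?_
  have hc := (continuous_height (L := L)).continuousAt (x := x)
  refine (continuousAt_const (y := side x)).congr ?_
  rcases lt_or_gt_of_ne hx with h | h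
  · filter_upwards [hc.eventually (gt_mem_nhds h)] with z hz
    exact pole_ext (by rw [height_side, height_side, if_neg h.not_ge, if_neg hz.not_ge])
  · filter_upwards [hc.eventually (lt_mem_nhds h)] with z hz
    exact pole_ext (by rw [height_side, height_side, if_pos h.le, if_pos hz.le])

/-- The standard tube of the suspension: `N` is the complement of `L × {0}`, with retraction to
the nearer pole, distance `1 - |t|` and trivialization `(y, ±1, t) ↦ [y, ±(1 - t)]`. -/
def standardTube (L : Type u) [TopologicalSpace L] : TrivialTube L (Susp L) (poles L) where
  isClosed := isClosed_poles
  e := tube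
  isOpenEmbedding := .of_continuous_injective_isOpenMap continuous_tube tube_injective
    isOpenMap_tube
  not_mem := tube_not_mem
  isOpen_nhd := by
    rw [range_tube]
    exact isOpen_ne_fun continuous_height continuous_const
  proj := side
  dist x := 1 - |height x|
  proj_continuousOn := by
    rw [range_tube]
    exact continuousOn_side
  dist_continuousOn := (continuous_const.sub continuous_height.abs).continuousOn
  proj_self := side_pole
  dist_self s := by rcases s.2 with h | h <;> simp [h]
  proj_e := side_tube
  dist_e a := by rw [abs_height_tube]; ring

end Topology

end Susp

end

end HISusp

open HISusp

namespace HISusp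

noncomputable section

/-! The intersection space is a mapping cone whose attaching map is, on homology, the fold of two
copies of `f`. The blow-up is a cylinder on `L`, so `Blow.toLink` is a homotopy equivalence onto
`L`, and it carries `g` to `f` composed with the projection `L_{<k} × Σ → L_{<k}`. As `Σ` is two
points, `H_n(L_{<k} × Σ)` is `H_n(L_{<k})²` and `g_*` becomes `(x, y) ↦ f_*(x + y)`. For `n < k` the
map `f_*` is an isomorphism, so `g_*` is onto and its kernel is the antidiagonal, a copy of
`H_n(L)`. For `n ≥ k` the source vanishes, so the kernel is zero and the cokernel is `H_n(L)`.

Over a field the exact sequence of a mapping cone splits: in degree `n + 1` the homology is the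
cokernel of `g_*` in degree `n + 1` plus the kernel of `g_*` in degree `n`
(`MappingCone.homology_equiv`). In degree `j > 0` the cokernel contributes `H_j(L)` exactly when `j
≥ k`, and the kernel contributes `H_{j-1}(L)` exactly when `j ≤ k`; the two overlap only at `j = k`.
The kernel is unreduced, which yields `H_0(L)` in degree one: for `k > 0` a single cone point joins
both ends of the cylinder and closes up a loop. In degrees `j ≤ 0` everything vanishes, because the
spaces are path connected.

The exact sequence comes from Mayer-Vietoris for the complement of the cone point and the open cone
(`mayerVietoris_equiv`). This rests on the theorem of small simplices: barycentric subdivision is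
built on affine chains, where it is a recursion on cones, and is transported to singular chains by
naturality. The mesh shrinks by the factor `n / (n + 1)`, and a Lebesgue number finishes the
argument. -/

/-! ### Chains on tuples of points -/

/-- Formal real combinations of `n`-tuples of points of `P`: the augmented ordered chains of the
full simplex on `P`, indexed by the number of vertices. -/
abbrev TupleChain (P : Type*) (n : ℕ) : Type _ := (Fin n → P) →₀ ℝ

namespace TupleChain

variable {P Q : Type*}

/-- The alternating sum of the faces. -/
def bd (P : Type*) (n : ℕ) : TupleChain P (n + 1) →ₗ[ℝ] TupleChain P n :=
  Finsupp.linearCombination ℝ fun v => ∑ i : Fin (n + 1),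
    (-1 : ℝ) ^ (i : ℕ) • Finsupp.single (v ∘ i.succAbove) (1 : ℝ)

theorem bd_single {n : ℕ} (v : Fin (n + 1) → P) :
    bd P n (Finsupp.single v 1) =
      ∑ i : Fin (n + 1), (-1 : ℝ) ^ (i : ℕ) • Finsupp.single (v ∘ i.succAbove) (1 : ℝ) := by
  simp [bd]

theorem bd_bd_single {n : ℕ} (v : Fin (n + 2) → P) :
    bd P n (bd P (n + 1) (Finsupp.single v 1)) = 0 := by
  simp only [bd_single, map_sum, map_smul, Finset.smul_sum, smul_smul, ← pow_add]
  rw [← Finset.sum_product']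
  -- Two vertices can be deleted in either order; the involution exchanges the two orders, which
  -- give the same face with opposite signs.
  refine Finset.sum_involution (fun x _ => (x.1.succAbove x.2, x.2.predAbove x.1)) ?_ ?_ ?_ ?_
  · rintro ⟨i, j⟩ -
    dsimp only
    have h : (v ∘ (i.succAbove j).succAbove) ∘ (j.predAbove i).succAbove =
        (v ∘ i.succAbove) ∘ j.succAbove := by
      ext k
      simp [Fin.succAbove_succAbove_succAbove_predAbove]
    rw [h, Fin.neg_one_pow_succAbove_add_predAbove, ← add_smul]
    simp [pow_add]
  · rintro ⟨i, j⟩ - - h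
    exact Fin.succAbove_ne i j (Prod.ext_iff.1 h).1
  · simp
  · rintro ⟨i, j⟩ -
    simp [Fin.succAbove_succAbove_predAbove, Fin.predAbove_predAbove_succAbove]

theorem bd_bd {n : ℕ} (c : TupleChain P (n + 2)) : bd P n (bd P (n + 1) c) = 0 := by
  have : bd P n ∘ₗ bd P (n + 1) = 0 :=
    Finsupp.lhom_ext' fun v => LinearMap.ext_ring (by simpa using bd_bd_single v)
  exact LinearMap.congr_fun this c

/-- The chain map induced by a map of vertices. -/
def map (f : P → Q) (n : ℕ) : TupleChain P n →ₗ[ℝ] TupleChain Q n :=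
  Finsupp.lmapDomain ℝ ℝ (f ∘ ·)

@[simp]
theorem map_single (f : P → Q) {n : ℕ} (v : Fin n → P) (r : ℝ) :
    map f n (Finsupp.single v r) = Finsupp.single (f ∘ v) r := by
  simp [map]

theorem bd_map (f : P → Q) {n : ℕ} (c : TupleChain P (n + 1)) :
    bd Q n (map f (n + 1) c) = map f n (bd P n c) := by
  have : bd Q n ∘ₗ map f (n + 1) = map f n ∘ₗ bd P n :=
    Finsupp.lhom_ext' fun v => LinearMap.ext_ring (by
      simp [bd_single, Function.comp_assoc])
  exact LinearMap.congr_fun this c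

/-- The cone operator, which adds a vertex in front. -/
def cone (b : P) (n : ℕ) : TupleChain P n →ₗ[ℝ] TupleChain P (n + 1) :=
  Finsupp.lmapDomain ℝ ℝ fun v => (Fin.cons b v : Fin (n + 1) → P)

@[simp]
theorem cone_single (b : P) {n : ℕ} (v : Fin n → P) (r : ℝ) :
    cone b n (Finsupp.single v r) = Finsupp.single (Fin.cons b v : Fin (n + 1) → P) r := by
  simp [cone]

theorem map_cone (f : P → Q) (b : P) {n : ℕ} (c : TupleChain P n) :
    map f (n + 1) (cone b n c) = cone (f b) n (map f n c) := by
  have : map f (n + 1) ∘ₗ cone b n = cone (f b) n ∘ₗ map f n :=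
    Finsupp.lhom_ext' fun v => LinearMap.ext_ring (by
      have : f ∘ (Fin.cons b v : Fin (n + 1) → P) = Fin.cons (f b) (f ∘ v) := by
        ext i
        refine Fin.cases ?_ (fun i => ?_) i <;> simp
      simp [this])
  exact LinearMap.congr_fun this c

/-- The face opposite `b` is the original simplex and every other face is a cone on a face. Because
the complex is augmented, single points need no separate formula: their boundary is a multiple of
the empty tuple, whose cone is `b`. -/
theorem bd_cone_succ (b : P) {n : ℕ} (c : TupleChain P (n + 1)) :
    bd P (n + 1) (cone b (n + 1) c) = c - cone b n (bd P n c) := by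
  have : bd P (n + 1) ∘ₗ cone b (n + 1) = LinearMap.id - cone b n ∘ₗ bd P n :=
    Finsupp.lhom_ext' fun v => LinearMap.ext_ring (by
      have h0 : (Fin.cons b v : Fin (n + 2) → P) ∘ Fin.succ = v := by
        ext i
        simp
      have h : ∀ i : Fin (n + 1), (Fin.cons b v : Fin (n + 2) → P) ∘ i.succ.succAbove =
          Fin.cons b (v ∘ i.succAbove) := by
        intro i
        ext j
        refine Fin.cases ?_ (fun j => ?_) j <;> simp
      simp [bd_single, Fin.sum_univ_succ (n := n + 1), h, h0, pow_succ, Finset.sum_neg_distrib,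
        sub_eq_add_neg])
  exact LinearMap.congr_fun this c

end TupleChain

/-! ### Affine simplices -/

/-- The standard simplex with `n` vertices. -/
abbrev Spx (n : ℕ) : Type := stdSimplex ℝ (Fin n)

namespace Spx

variable {l m n : ℕ}

/-- The affine simplex with the given vertices. -/
def affine (v : Fin n → Spx m) : C(Spx n, Spx m) where
  toFun t := ⟨fun k => ∑ i, t.1 i * (v i).1 k, fun k => Finset.sum_nonneg fun i _ =>
    mul_nonneg (t.2.1 i) ((v i).2.1 k), by
      rw [Finset.sum_comm]
      simp_rw [← Finset.mul_sum, (v _).2.2, mul_one]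
      exact t.2.2⟩
  continuous_toFun := by
    refine Continuous.subtype_mk (continuous_pi fun k => continuous_finsetSum _ fun i _ => ?_) _
    exact ((continuous_apply i).comp continuous_subtype_val).mul continuous_const

theorem affine_apply (v : Fin n → Spx m) (t : Spx n) (k : Fin m) :
    (affine v t).1 k = ∑ i, t.1 i * (v i).1 k := rfl

/-- The vertices of the standard simplex. -/
def vertex (n : ℕ) (i : Fin n) : Spx n := stdSimplex.vertex i

theorem vertex_apply (i k : Fin n) : (vertex n i).1 k = if k = i then 1 else 0 := by
  simp [vertex, Pi.single_apply]

@[simp]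
theorem affine_vertex (v : Fin n → Spx m) (i : Fin n) : affine v (vertex n i) = v i := by
  ext k
  change (affine v (vertex n i)).1 k = (v i).1 k
  simp [affine_apply, vertex_apply]

theorem affine_comp_vertex (v : Fin n → Spx m) : affine v ∘ vertex n = v :=
  funext (affine_vertex v)

@[simp]
theorem affine_vertices : affine (vertex n) = ContinuousMap.id _ := by
  ext t k
  change (affine _ t).1 k = t.1 k
  simp [affine_apply, vertex_apply]

theorem affine_affine (w : Fin m → Spx l) (v : Fin n → Spx m) :
    affine (affine w ∘ v) = (affine w).comp (affine v) := by
  ext t k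
  change (affine _ t).1 k = (affine w (affine v t)).1 k
  simp only [affine_apply, Function.comp, Finset.mul_sum, Finset.sum_mul]
  rw [Finset.sum_comm]
  simp_rw [mul_assoc]

/-- The inclusion of a face. -/
def face (i : Fin (n + 1)) : C(Spx n, Spx (n + 1)) :=
  ⟨stdSimplex.map i.succAbove, stdSimplex.continuous_map _⟩

theorem face_eq (i : Fin (n + 1)) : face i = affine (vertex (n + 1) ∘ i.succAbove) := by
  ext t k
  change FunOnFinite.linearMap ℝ ℝ _ _ _ = (affine _ t).1 k
  simp only [FunOnFinite.linearMap_apply_apply, affine_apply, Function.comp, vertex_apply]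
  rw [Finset.sum_filter]
  refine Finset.sum_congr rfl fun j _ => ?_
  simp only [mul_ite, mul_one, mul_zero, eq_comm]
  rfl

theorem affine_comp_face (v : Fin (n + 1) → Spx m) (i : Fin (n + 1)) :
    (affine v).comp (face i) = affine (v ∘ i.succAbove) := by
  rw [face_eq, ← affine_affine, ← Function.comp_assoc, affine_comp_vertex]

/-- The barycentre of an affine simplex. -/
def bary (v : Fin (n + 1) → Spx m) : Spx m := affine v stdSimplex.barycenter

theorem bary_affine (w : Fin m → Spx l) (v : Fin (n + 1) → Spx m) :
    bary (affine w ∘ v) = affine w (bary v) := by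
  simp [bary, affine_affine]

/-- Balls are convex. The metric on the simplex is the sup metric, so the estimate is made in each
coordinate. -/
theorem dist_affine_le (v : Fin n → Spx m) (x : Spx m) {d : ℝ} (hd : 0 ≤ d)
    (h : ∀ i, dist x (v i) ≤ d) (t : Spx n) : dist x (affine v t) ≤ d := by
  refine (dist_pi_le_iff hd).2 fun k => ?_
  have hx : x.1 k = ∑ i, t.1 i * x.1 k := by rw [← Finset.sum_mul, t.2.2, one_mul]
  rw [Real.dist_eq, hx, affine_apply, ← Finset.sum_sub_distrib]
  calc |∑ i, (t.1 i * x.1 k - t.1 i * (v i).1 k)|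
      ≤ ∑ i, |t.1 i * x.1 k - t.1 i * (v i).1 k| := Finset.abs_sum_le_sum_abs _ _
    _ ≤ ∑ i, t.1 i * d := by
        refine Finset.sum_le_sum fun i _ => ?_
        rw [← mul_sub, abs_mul, abs_of_nonneg (t.2.1 i)]
        exact mul_le_mul_of_nonneg_left ((dist_le_pi_dist x.1 (v i).1 k).trans (h i)) (t.2.1 i)
    _ = d := by rw [← Finset.sum_mul, t.2.2, one_mul]

/-- The difference `bary v - v j` averages the `n + 1` differences `v i - v j`, one of which is
zero; hence the factor `n / (n + 1)`. -/
theorem dist_bary_le (v : Fin (n + 1) → Spx m) {d : ℝ} (hd : 0 ≤ d)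
    (h : ∀ i j, dist (v i) (v j) ≤ d) (j : Fin (n + 1)) :
    dist (bary v) (v j) ≤ n / (n + 1) * d := by
  refine (dist_pi_le_iff (by positivity)).2 fun k => ?_
  have h1 : (bary v).1 k - (v j).1 k = ((n : ℝ) + 1)⁻¹ * ∑ i, ((v i).1 k - (v j).1 k) := by
    have : (bary v).1 k = ((n : ℝ) + 1)⁻¹ * ∑ i, (v i).1 k := by
      simp [bary, affine_apply, Finset.mul_sum]
    rw [this, Finset.sum_sub_distrib]
    simp only [Finset.sum_const, Finset.card_univ, Fintype.card_fin, nsmul_eq_mul]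
    push_cast
    field_simp
  have h2 : |∑ i, ((v i).1 k - (v j).1 k)| ≤ n * d := by
    rw [Fin.sum_univ_succAbove _ j, sub_self, zero_add]
    refine (Finset.abs_sum_le_sum_abs _ _).trans ?_
    refine (Finset.sum_le_sum (g := fun _ => d) fun i _ => ?_).trans (by simp)
    exact (dist_le_pi_dist (v (j.succAbove i)).1 (v j).1 k).trans (h _ _)
  rw [Real.dist_eq, h1, abs_mul, abs_of_pos (by positivity), div_mul_eq_mul_div, div_eq_inv_mul]
  exact mul_le_mul_of_nonneg_left h2 (by positivity)

end Spx

/-! ### Barycentric subdivision of affine chains -/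

section

namespace TupleChain

open Spx

variable {l m : ℕ}

/-- Barycentric subdivision. -/
def sd (m : ℕ) : ∀ n, TupleChain (Spx m) n →ₗ[ℝ] TupleChain (Spx m) n
  | 0 => LinearMap.id
  | n + 1 => Finsupp.linearCombination ℝ fun v =>
      cone (bary v) n (sd m n (bd _ n (Finsupp.single v 1)))

/-- The chain homotopy between the identity and barycentric subdivision. -/
def sdHomotopy (m : ℕ) : ∀ n, TupleChain (Spx m) n →ₗ[ℝ] TupleChain (Spx m) (n + 1)
  | 0 => 0
  | n + 1 => Finsupp.linearCombination ℝ fun v =>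
      cone (bary v) (n + 1) (Finsupp.single v 1 - sdHomotopy m n (bd _ n (Finsupp.single v 1)))

theorem sd_single {n : ℕ} (v : Fin (n + 1) → Spx m) :
    sd m (n + 1) (Finsupp.single v 1) =
      cone (bary v) n (sd m n (bd _ n (Finsupp.single v 1))) := by
  simp [sd]

theorem sdHomotopy_single {n : ℕ} (v : Fin (n + 1) → Spx m) :
    sdHomotopy m (n + 1) (Finsupp.single v 1) = cone (bary v) (n + 1)
      (Finsupp.single v 1 - sdHomotopy m n (bd _ n (Finsupp.single v 1))) := by
  simp [sdHomotopy]

theorem linearMap_ext {P M : Type*} [AddCommGroup M] [Module ℝ M] {n : ℕ}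
    {f g : TupleChain P n →ₗ[ℝ] M}
    (h : ∀ v, f (Finsupp.single v 1) = g (Finsupp.single v 1)) : f = g :=
  Finsupp.lhom_ext' fun v => LinearMap.ext_ring (h v)

/-- Affine maps preserve barycentres and commute with cones, hence with the recursion. This
naturality is what makes subdivision of singular chains compatible with `realize`. -/
theorem sd_map_affine (w : Fin m → Spx l) : ∀ {n : ℕ} (c : TupleChain (Spx m) n),
    sd l n (map (affine w) n c) = map (affine w) n (sd m n c)
  | 0, c => rfl
  | n + 1, c => by
    have : sd l (n + 1) ∘ₗ map (affine w) (n + 1) = map (affine w) (n + 1) ∘ₗ sd m (n + 1) :=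
      linearMap_ext fun v => by
        simp only [LinearMap.comp_apply, map_single, sd_single, map_cone, ← bary_affine,
          ← sd_map_affine w, ← bd_map]
    exact LinearMap.congr_fun this c

theorem sdHomotopy_map_affine (w : Fin m → Spx l) : ∀ {n : ℕ} (c : TupleChain (Spx m) n),
    sdHomotopy l n (map (affine w) n c) = map (affine w) (n + 1) (sdHomotopy m n c)
  | 0, c => by simp [sdHomotopy]
  | n + 1, c => by
    have : sdHomotopy l (n + 1) ∘ₗ map (affine w) (n + 1) =
        map (affine w) (n + 2) ∘ₗ sdHomotopy m (n + 1) :=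
      linearMap_ext fun v => by
        simp only [LinearMap.comp_apply, map_single, sdHomotopy_single, map_cone, ← bary_affine,
          map_sub, ← sdHomotopy_map_affine w, ← bd_map]
    exact LinearMap.congr_fun this c

theorem bd_sdHomotopy_zero (c : TupleChain (Spx m) 0) :
    bd _ 0 (sdHomotopy m 0 c) = c - sd m 0 c := by
  simp [sd, sdHomotopy]

/-- Induction through the cone formula. That `sd` commutes with the boundary is not needed as an
input. -/
theorem bd_sdHomotopy : ∀ {n : ℕ} (c : TupleChain (Spx m) (n + 1)),
    bd _ (n + 1) (sdHomotopy m (n + 1) c) =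
      c - sd m (n + 1) c - sdHomotopy m n (bd _ n c) := by
  intro n
  -- The identity one degree lower, applied to a boundary: its last term disappears because `bd`
  -- squares to zero.
  have key : ∀ v : Fin (n + 1) → Spx m, bd _ n (sdHomotopy m n (bd _ n (Finsupp.single v 1))) =
      bd _ n (Finsupp.single v 1) - sd m n (bd _ n (Finsupp.single v 1)) := by
    intro v
    cases n with
    | zero => exact bd_sdHomotopy_zero _
    | succ n => rw [bd_sdHomotopy, bd_bd, map_zero, sub_zero]
  intro c
  have : bd _ (n + 1) ∘ₗ sdHomotopy m (n + 1) =
      LinearMap.id - sd m (n + 1) - sdHomotopy m n ∘ₗ bd _ n :=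
    linearMap_ext fun v => by
      simp only [LinearMap.comp_apply, sdHomotopy_single, bd_cone_succ, LinearMap.sub_apply,
        LinearMap.id_apply, sd_single, map_sub, key]
      abel
  exact LinearMap.congr_fun this c

/-! ### The mesh of iterated subdivisions -/

/-- Chains of affine simplices of diameter at most `d` with all vertices in a set `s`. -/
def fine (s : Set (Spx m)) (n : ℕ) (d : ℝ) : Submodule ℝ (TupleChain (Spx m) n) :=
  Finsupp.supported ℝ ℝ {v | (∀ i j, dist (v i) (v j) ≤ d) ∧ ∀ i, v i ∈ s}

theorem single_mem_fine {s : Set (Spx m)} {n : ℕ} {d : ℝ} {v : Fin n → Spx m}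
    (h : ∀ i j, dist (v i) (v j) ≤ d) (hs : ∀ i, v i ∈ s) :
    Finsupp.single v (1 : ℝ) ∈ fine s n d :=
  Finsupp.single_mem_supported ℝ _ ⟨h, hs⟩

theorem fine_mono {s t : Set (Spx m)} (hst : s ⊆ t) {n : ℕ} {d e : ℝ} (h : d ≤ e) :
    fine s n d ≤ fine t n e :=
  Finsupp.supported_mono fun _ hv => ⟨fun i j => (hv.1 i j).trans h, fun i => hst (hv.2 i)⟩

theorem fine_le {s : Set (Spx m)} {n : ℕ} {d : ℝ} {N : Submodule ℝ (TupleChain (Spx m) n)}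
    (h : ∀ v : Fin n → Spx m, (∀ i j, dist (v i) (v j) ≤ d) → (∀ i, v i ∈ s) →
      Finsupp.single v (1 : ℝ) ∈ N) : fine s n d ≤ N := by
  rw [fine, Finsupp.supported_eq_span_single, Submodule.span_le]
  rintro _ ⟨v, hv, rfl⟩
  exact h v hv.1 hv.2

/-- A simplex of the subdivision is the barycentre joined to a simplex from a subdivided face. Edges
within the face are short by induction; edges at the barycentre are short because their other end
lies in the convex hull of `v`. This is why the statement also records that all vertices stay in
`range (affine v)`. -/
theorem sd_single_mem_fine : ∀ {n : ℕ} (v : Fin (n + 1) → Spx m) {d : ℝ}, 0 ≤ d →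
    (∀ i j, dist (v i) (v j) ≤ d) →
    sd m (n + 1) (Finsupp.single v 1) ∈ fine (range (affine v)) (n + 1) (n / (n + 1) * d) := by
  intro n v d hd hv
  have hb : bary v ∈ range (affine v) := ⟨_, rfl⟩
  have hsub : ∀ i : Fin (n + 1), sd m n (Finsupp.single (v ∘ i.succAbove) 1) ∈
      fine (range (affine v)) n (n / (n + 1) * d) := by
    intro i
    cases n with
    | zero => exact single_mem_fine (fun i => i.elim0) fun i => i.elim0
    | succ n =>
      refine fine_mono ?_ ?_ (sd_single_mem_fine (v ∘ i.succAbove) hd fun _ _ => hv _ _)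
      -- The subdivided face lies in the image of the whole simplex, and its smaller contraction
      -- factor is bounded by `n / (n + 1)`, an increasing function of `n`.
      · rw [← affine_comp_face]
        exact range_comp_subset_range (face i) (affine v)
      · refine mul_le_mul_of_nonneg_right ?_ hd
        rw [div_le_div_iff₀ (by positivity) (by positivity)]
        push_cast
        nlinarith
  rw [sd_single, bd_single, map_sum]
  have hcone : fine (range (affine v)) n (n / (n + 1) * d) ≤
      (fine (range (affine v)) (n + 1) (n / (n + 1) * d)).comap (cone (bary v) n) := by
    refine fine_le fun w hw hwv => ?_
    rw [Submodule.mem_comap, cone_single]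
    have hbw : ∀ i, dist (bary v) (w i) ≤ n / (n + 1) * d := by
      intro i
      obtain ⟨t, ht⟩ := hwv i
      rw [← ht]
      exact dist_affine_le v _ (by positivity) (dist_bary_le v hd hv) t
    refine single_mem_fine (fun i j => ?_) fun i => ?_
    · refine Fin.cases ?_ (fun i => ?_) i <;> refine Fin.cases ?_ (fun j => ?_) j
      · simpa using (by positivity : 0 ≤ n / (n + 1) * d)
      · simpa using hbw j
      · simpa [dist_comm] using hbw i
      · simpa using hw i j
    · refine Fin.cases ?_ (fun i => ?_) i
      · exact hb
      · exact hwv i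
  refine hcone (Submodule.sum_mem _ fun i _ => ?_)
  rw [map_smul]
  exact Submodule.smul_mem _ _ (hsub i)

theorem sd_mem_fine {n : ℕ} {d : ℝ} (hd : 0 ≤ d) {c : TupleChain (Spx m) (n + 1)}
    (hc : c ∈ fine univ (n + 1) d) : sd m (n + 1) c ∈ fine univ (n + 1) (n / (n + 1) * d) := by
  refine fine_le (N := (fine univ (n + 1) (n / (n + 1) * d)).comap (sd m (n + 1)))
    (fun v hv _ => ?_) hc
  exact fine_mono (subset_univ _) le_rfl (sd_single_mem_fine v hd hv)

theorem exists_sd_iterate_mem_fine {n : ℕ} {ε : ℝ} (hε : 0 < ε) (v : Fin (n + 1) → Spx m) :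
    ∃ k, ((sd m (n + 1))^[k]) (Finsupp.single v 1) ∈ fine univ (n + 1) ε := by
  obtain ⟨d, hd, hv⟩ : ∃ d, 0 ≤ d ∧ ∀ i j, dist (v i) (v j) ≤ d :=
    ⟨Metric.diam (range v), Metric.diam_nonneg, fun i j =>
      Metric.dist_le_diam_of_mem (finite_range v).isBounded (mem_range_self i) (mem_range_self j)⟩
  have h : ∀ k, ((sd m (n + 1))^[k]) (Finsupp.single v 1) ∈
      fine univ (n + 1) (((n : ℝ) / (n + 1)) ^ k * d) := by
    intro k
    induction k with
    | zero => simpa using single_mem_fine hv fun i => mem_univ _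
    | succ k ih =>
      rw [Function.iterate_succ_apply', pow_succ', mul_assoc]
      exact sd_mem_fine (by positivity) ih
  have hlt : (n : ℝ) / (n + 1) < 1 := by
    rw [div_lt_one (by positivity)]
    linarith
  have hlim : Filter.Tendsto (fun k : ℕ => ((n : ℝ) / (n + 1)) ^ k * d) Filter.atTop
      (nhds (0 * d)) :=
    (tendsto_pow_atTop_nhds_zero_of_lt_one (by positivity) hlt).mul_const d
  rw [zero_mul] at hlim
  obtain ⟨k, hk⟩ := (hlim.eventually (gt_mem_nhds hε)).exists
  exact ⟨k, fine_mono subset_rfl hk.le (h k)⟩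

end TupleChain

/-! ### Singular chains -/

/-- Real singular `n`-chains, with singular simplices as continuous maps out of `Spx (n + 1)`. -/
abbrev Chain (n : ℕ) (X : Type*) [TopologicalSpace X] : Type _ := C(Spx (n + 1), X) →₀ ℝ

namespace Chain

variable {X Y Z : Type*} [TopologicalSpace X] [TopologicalSpace Y] [TopologicalSpace Z]

theorem linearMap_ext {M : Type*} [AddCommGroup M] [Module ℝ M] {n : ℕ}
    {f g : Chain n X →ₗ[ℝ] M}
    (h : ∀ σ, f (Finsupp.single σ 1) = g (Finsupp.single σ 1)) : f = g :=
  Finsupp.lhom_ext' fun v => LinearMap.ext_ring (h v)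

/-- The boundary of a singular chain of positive degree. -/
def bdSucc (n : ℕ) (X : Type*) [TopologicalSpace X] : Chain (n + 1) X →ₗ[ℝ] Chain n X :=
  Finsupp.linearCombination ℝ fun σ => ∑ i : Fin (n + 2),
    (-1 : ℝ) ^ (i : ℕ) • Finsupp.single (σ.comp (Spx.face i)) (1 : ℝ)

/-- The boundary of a singular chain; it is zero on chains of degree zero. -/
def bd : ∀ (n : ℕ) (X : Type*) [TopologicalSpace X], Chain n X →ₗ[ℝ] Chain (n - 1) X
  -- Truncated subtraction makes the target `Chain 0 X` again, so statements about `bd n` have the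
  -- same form for all `n`.
  | 0, _, _ => 0
  | n + 1, X, _ => bdSucc n X

/-- The chain map induced by a continuous map. -/
def map (f : C(X, Y)) (n : ℕ) : Chain n X →ₗ[ℝ] Chain n Y :=
  Finsupp.lmapDomain ℝ ℝ f.comp

@[simp]
theorem map_single (f : C(X, Y)) {n : ℕ} (σ : C(Spx (n + 1), X)) (r : ℝ) :
    map f n (Finsupp.single σ r) = Finsupp.single (f.comp σ) r := by
  simp [map]

theorem bdSucc_single {n : ℕ} (σ : C(Spx (n + 2), X)) :
    bdSucc n X (Finsupp.single σ 1) = ∑ i : Fin (n + 2),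
      (-1 : ℝ) ^ (i : ℕ) • Finsupp.single (σ.comp (Spx.face i)) (1 : ℝ) := by
  simp [bdSucc]

theorem bdSucc_map (f : C(X, Y)) {n : ℕ} (c : Chain (n + 1) X) :
    bdSucc n Y (map f (n + 1) c) = map f n (bdSucc n X c) := by
  have : bdSucc n Y ∘ₗ map f (n + 1) = map f n ∘ₗ bdSucc n X := linearMap_ext fun σ => by
    simp [bdSucc_single, ContinuousMap.comp_assoc]
  exact LinearMap.congr_fun this c

theorem bd_map (f : C(X, Y)) : ∀ {n : ℕ} (c : Chain n X),
    bd n Y (map f n c) = map f (n - 1) (bd n X c)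
  | 0, _ => by simp [bd]
  | _ + 1, c => bdSucc_map f c

theorem map_map (g : C(Y, Z)) (f : C(X, Y)) {n : ℕ} (c : Chain n X) :
    map g n (map f n c) = map (g.comp f) n c := by
  have : map g n ∘ₗ map f n = map (g.comp f) n := linearMap_ext fun σ => by
    simp [ContinuousMap.comp_assoc]
  exact LinearMap.congr_fun this c

/-- The singular chain in `X` of a chain of affine simplices in the domain of `σ`. -/
def realize {m : ℕ} (σ : C(Spx m, X)) (n : ℕ) : TupleChain (Spx m) (n + 1) →ₗ[ℝ] Chain n X :=
  Finsupp.lmapDomain ℝ ℝ fun v => σ.comp (Spx.affine v)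

@[simp]
theorem realize_single {m n : ℕ} (σ : C(Spx m, X)) (v : Fin (n + 1) → Spx m) (r : ℝ) :
    realize σ n (Finsupp.single v r) = Finsupp.single (σ.comp (Spx.affine v)) r := by
  simp [realize]

/-- Every singular simplex is the realization of the tautological affine simplex. Through this,
identities between affine chains become identities between singular chains. -/
theorem realize_vertex {n : ℕ} (σ : C(Spx (n + 1), X)) :
    realize σ n (Finsupp.single (Spx.vertex (n + 1)) 1) = Finsupp.single σ 1 := by
  simp

theorem bdSucc_realize {m n : ℕ} (σ : C(Spx m, X)) (c : TupleChain (Spx m) (n + 2)) :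
    bdSucc n X (realize σ (n + 1) c) = realize σ n (TupleChain.bd _ (n + 1) c) := by
  have : bdSucc n X ∘ₗ realize σ (n + 1) = realize σ n ∘ₗ TupleChain.bd _ (n + 1) :=
    TupleChain.linearMap_ext fun v => by
      simp [bdSucc_single, TupleChain.bd_single, ContinuousMap.comp_assoc, Spx.affine_comp_face]
  exact LinearMap.congr_fun this c

theorem realize_comp_affine {l m n : ℕ} (σ : C(Spx m, X)) (w : Fin l → Spx m)
    (c : TupleChain (Spx l) (n + 1)) :
    realize (σ.comp (Spx.affine w)) n c = realize σ n (TupleChain.map (Spx.affine w) _ c) := by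
  have : realize (σ.comp (Spx.affine w)) n =
      realize σ n ∘ₗ TupleChain.map (Spx.affine w) (n + 1) :=
    TupleChain.linearMap_ext fun v => by
      simp [ContinuousMap.comp_assoc, Spx.affine_affine]
  exact LinearMap.congr_fun this c

theorem bdSucc_bdSucc {n : ℕ} (c : Chain (n + 2) X) : bdSucc n X (bdSucc (n + 1) X c) = 0 := by
  have : bdSucc n X ∘ₗ bdSucc (n + 1) X = 0 := linearMap_ext fun σ => by
    rw [LinearMap.comp_apply, ← realize_vertex, bdSucc_realize, bdSucc_realize,
      TupleChain.bd_bd, map_zero, LinearMap.zero_apply]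
  exact LinearMap.congr_fun this c

theorem bd_bdSucc : ∀ {n : ℕ} (c : Chain (n + 1) X), bd n X (bdSucc n X c) = 0
  | 0, _ => by simp [bd]
  | _ + 1, c => bdSucc_bdSucc c

/-! ### Subdivision of singular chains -/

/-- Barycentric subdivision of singular chains. -/
def sd (n : ℕ) (X : Type*) [TopologicalSpace X] : Chain n X →ₗ[ℝ] Chain n X :=
  Finsupp.linearCombination ℝ fun σ =>
    realize σ n (TupleChain.sd _ _ (Finsupp.single (Spx.vertex (n + 1)) 1))

/-- The chain homotopy between the identity and barycentric subdivision. -/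
def sdHomotopy (n : ℕ) (X : Type*) [TopologicalSpace X] : Chain n X →ₗ[ℝ] Chain (n + 1) X :=
  Finsupp.linearCombination ℝ fun σ =>
    realize σ (n + 1) (TupleChain.sdHomotopy _ _ (Finsupp.single (Spx.vertex (n + 1)) 1))

/-- The definition only subdivides the tautological simplex; naturality under affine maps extends
the formula to all affine chains in the domain of `σ`. -/
theorem sd_realize {m n : ℕ} (σ : C(Spx m, X)) (c : TupleChain (Spx m) (n + 1)) :
    sd n X (realize σ n c) = realize σ n (TupleChain.sd m _ c) := by
  have : sd n X ∘ₗ realize σ n = realize σ n ∘ₗ TupleChain.sd m (n + 1) :=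
    TupleChain.linearMap_ext fun v => by
      simp only [LinearMap.comp_apply, realize_single, sd, Finsupp.linearCombination_single,
        one_smul, realize_comp_affine, ← TupleChain.sd_map_affine, TupleChain.map_single,
        Spx.affine_comp_vertex]
  exact LinearMap.congr_fun this c

theorem sdHomotopy_realize {m n : ℕ} (σ : C(Spx m, X)) (c : TupleChain (Spx m) (n + 1)) :
    sdHomotopy n X (realize σ n c) = realize σ (n + 1) (TupleChain.sdHomotopy m _ c) := by
  have : sdHomotopy n X ∘ₗ realize σ n = realize σ (n + 1) ∘ₗ TupleChain.sdHomotopy m (n + 1) :=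
    TupleChain.linearMap_ext fun v => by
      simp only [LinearMap.comp_apply, realize_single, sdHomotopy,
        Finsupp.linearCombination_single, one_smul, realize_comp_affine,
        ← TupleChain.sdHomotopy_map_affine, TupleChain.map_single, Spx.affine_comp_vertex]
  exact LinearMap.congr_fun this c

theorem sub_sd_zero (c : Chain 0 X) : c - sd 0 X c = bdSucc 0 X (sdHomotopy 0 X c) := by
  have : LinearMap.id - sd 0 X = bdSucc 0 X ∘ₗ sdHomotopy 0 X := linearMap_ext fun σ => by
    simp only [LinearMap.sub_apply, LinearMap.id_apply, LinearMap.comp_apply]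
    rw [← realize_vertex, sd_realize, sdHomotopy_realize, bdSucc_realize,
      TupleChain.bd_sdHomotopy, map_sub, map_sub, eq_comm, sub_eq_self]
    -- The remaining term comes from the augmentation, where the homotopy is zero by definition.
    have : TupleChain.sdHomotopy 1 0 = 0 := rfl
    rw [this, LinearMap.zero_apply, map_zero]
  exact LinearMap.congr_fun this c

theorem sub_sd_succ {n : ℕ} (c : Chain (n + 1) X) : c - sd (n + 1) X c =
    bdSucc (n + 1) X (sdHomotopy (n + 1) X c) + sdHomotopy n X (bdSucc n X c) := by
  have : LinearMap.id - sd (n + 1) X =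
      bdSucc (n + 1) X ∘ₗ sdHomotopy (n + 1) X + sdHomotopy n X ∘ₗ bdSucc n X :=
    linearMap_ext fun σ => by
      simp only [LinearMap.sub_apply, LinearMap.id_apply, LinearMap.comp_apply,
        LinearMap.add_apply]
      rw [← realize_vertex, sd_realize, sdHomotopy_realize, bdSucc_realize, bdSucc_realize,
        sdHomotopy_realize, TupleChain.bd_sdHomotopy, map_sub, map_sub, sub_add_cancel]
  exact LinearMap.congr_fun this c

end Chain

end

/-! ### The theorem of small simplices -/

namespace Chain

variable {X Y : Type*} [TopologicalSpace X] [TopologicalSpace Y]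

/-- The chains of simplices that lie in `U`. -/
def within (U : Set X) (n : ℕ) : Submodule ℝ (Chain n X) :=
  Finsupp.supported ℝ ℝ {σ | range σ ⊆ U}

/-- The chains of simplices each of which lies in `U` or in `V`. -/
def small (U V : Set X) (n : ℕ) : Submodule ℝ (Chain n X) :=
  Finsupp.supported ℝ ℝ {σ | range σ ⊆ U ∨ range σ ⊆ V}

theorem within_sup_within (U V : Set X) (n : ℕ) : within U n ⊔ within V n = small U V n :=
  (Finsupp.supported_union _ _).symm

theorem within_inf_within (U V : Set X) (n : ℕ) : within U n ⊓ within V n = within (U ∩ V) n := by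
  rw [within, within, ← Finsupp.supported_inter]
  congr 1
  ext σ
  exact subset_inter_iff.symm

theorem single_mem_small {U V : Set X} {n : ℕ} {σ : C(Spx (n + 1), X)}
    (h : range σ ⊆ U ∨ range σ ⊆ V) : Finsupp.single σ (1 : ℝ) ∈ small U V n :=
  Finsupp.single_mem_supported ℝ _ h

theorem small_le {U V : Set X} {n : ℕ} {N : Submodule ℝ (Chain n X)}
    (h : ∀ σ : C(Spx (n + 1), X), range σ ⊆ U ∨ range σ ⊆ V → Finsupp.single σ (1 : ℝ) ∈ N) :
    small U V n ≤ N := by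
  rw [small, Finsupp.supported_eq_span_single, Submodule.span_le]
  rintro _ ⟨σ, hσ, rfl⟩
  exact h σ hσ

theorem realize_mem_small {U V : Set X} {m n : ℕ} {σ : C(Spx m, X)}
    (h : range σ ⊆ U ∨ range σ ⊆ V) (c : TupleChain (Spx m) (n + 1)) :
    realize σ n c ∈ small U V n := by
  induction c using Finsupp.induction_linear with
  | zero => simp
  | add a b ha hb => rw [map_add]; exact Submodule.add_mem _ ha hb
  | single v r =>
    rw [realize_single]
    have := range_comp_subset_range (Spx.affine v) σ
    exact Finsupp.single_mem_supported ℝ _ (h.imp this.trans this.trans)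

theorem bdSucc_mem_small {U V : Set X} {n : ℕ} {c : Chain (n + 1) X} (hc : c ∈ small U V (n + 1)) :
    bdSucc n X c ∈ small U V n := by
  refine small_le (N := (small U V n).comap (bdSucc n X)) (fun σ hσ => ?_) hc
  rw [Submodule.mem_comap, ← realize_vertex, bdSucc_realize]
  exact realize_mem_small hσ _

theorem bd_mem_small {U V : Set X} : ∀ {n : ℕ} {c : Chain n X}, c ∈ small U V n →
    bd n X c ∈ small U V (n - 1)
  | 0, _, _ => zero_mem _
  | _ + 1, _, hc => bdSucc_mem_small hc

theorem sd_mem_small {U V : Set X} {n : ℕ} {c : Chain n X} (hc : c ∈ small U V n) :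
    sd n X c ∈ small U V n := by
  refine small_le (N := (small U V n).comap (sd n X)) (fun σ hσ => ?_) hc
  rw [Submodule.mem_comap, ← realize_vertex, sd_realize]
  exact realize_mem_small hσ _

theorem sdHomotopy_mem_small {U V : Set X} {n : ℕ} {c : Chain n X} (hc : c ∈ small U V n) :
    sdHomotopy n X c ∈ small U V (n + 1) := by
  refine small_le (N := (small U V (n + 1)).comap (sdHomotopy n X)) (fun σ hσ => ?_) hc
  rw [Submodule.mem_comap, ← realize_vertex, sdHomotopy_realize]
  exact realize_mem_small hσ _

theorem iterate_sd_mem_small {U V : Set X} {n : ℕ} {c : Chain n X} (hc : c ∈ small U V n)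
    (k : ℕ) : (sd n X)^[k] c ∈ small U V n := by
  induction k with
  | zero => exact hc
  | succ k ih => rw [Function.iterate_succ_apply']; exact sd_mem_small ih

theorem iterate_sd_realize {m n : ℕ} (σ : C(Spx m, X)) (c : TupleChain (Spx m) (n + 1)) (k : ℕ) :
    (sd n X)^[k] (realize σ n c) = realize σ n ((TupleChain.sd m (n + 1))^[k] c) := by
  induction k with
  | zero => rfl
  | succ k ih => rw [Function.iterate_succ_apply', Function.iterate_succ_apply', ih, sd_realize]

/-- Sufficiently fine subdivisions of a chain are small. -/
theorem exists_iterate_sd_mem_small {U V : Set X} (hU : IsOpen U) (hV : IsOpen V)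
    (hUV : U ∪ V = univ) {n : ℕ} (c : Chain n X) : ∃ k, (sd n X)^[k] c ∈ small U V n := by
  induction c using Finsupp.induction_linear with
  | zero => exact ⟨0, zero_mem _⟩
  | add a b ha hb =>
    obtain ⟨k, hk⟩ := ha
    obtain ⟨l, hl⟩ := hb
    -- Small chains stay small under further subdivision, so the sum of the exponents serves both
    -- summands.
    refine ⟨k + l, ?_⟩
    rw [iterate_map_add]
    refine Submodule.add_mem _ ?_ ?_
    · rw [add_comm k l, Function.iterate_add_apply]
      exact iterate_sd_mem_small hk l
    · rw [Function.iterate_add_apply]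
      exact iterate_sd_mem_small hl k
  | single σ r =>
    obtain ⟨δ, hδ, h⟩ := lebesgue_number_lemma_of_metric (s := (univ : Set (Spx (n + 1))))
      (c := fun b : Bool => σ ⁻¹' (bif b then U else V)) isCompact_univ
      (fun b => by cases b <;> exact IsOpen.preimage σ.continuous ‹_›)
      (fun t _ => by
        rcases (hUV ▸ mem_univ (σ t) : σ t ∈ U ∪ V) with ht | ht
        · exact mem_iUnion.2 ⟨true, ht⟩
        · exact mem_iUnion.2 ⟨false, ht⟩)
    -- Fineness is a non-strict bound; `δ / 2` keeps each simplex inside the open `δ`-ball about its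
    -- first vertex, hence in one member of the cover.
    obtain ⟨k, hk⟩ := TupleChain.exists_sd_iterate_mem_fine (half_pos hδ) (Spx.vertex (n + 1))
    refine ⟨k, ?_⟩
    rw [← mul_one r, ← smul_eq_mul, ← Finsupp.smul_single, ← realize_vertex, ← map_smul,
      iterate_sd_realize]
    refine TupleChain.fine_le (N := (small U V n).comap (realize σ n)) (d := δ / 2) (s := univ)
      (fun v hv _ => ?_) ?_
    · rw [Submodule.mem_comap, realize_single]
      obtain ⟨b, hb⟩ := h (v 0) (mem_univ _)
      have hr : range (σ.comp (Spx.affine v)) ⊆ bif b then U else V := by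
        rintro _ ⟨t, rfl⟩
        refine hb (Metric.mem_ball'.2 ?_)
        have := Spx.dist_affine_le v (v 0) (half_pos hδ).le (hv 0) t
        linarith
      refine single_mem_small ?_
      cases b
      · exact Or.inr hr
      · exact Or.inl hr
    · have : ∀ x, (TupleChain.sd (n + 1) (n + 1))^[k] (r • x) =
          r • (TupleChain.sd (n + 1) (n + 1))^[k] x := by
        intro x
        rw [← Module.End.pow_apply, map_smul, Module.End.pow_apply]
      rw [this]
      exact Submodule.smul_mem _ _ hk

/-- Induction on the number of subdivisions: `c` and `sd c` differ by a boundary plus the homotopy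
applied to the boundary of `c`, and the latter is small because that boundary is. -/
theorem exists_sub_bdSucc_mem_small_of_iterate {U V : Set X} {n : ℕ} (k : ℕ) : ∀ c : Chain n X,
    bd n X c ∈ small U V (n - 1) → (sd n X)^[k] c ∈ small U V n →
      ∃ d, c - bdSucc n X d ∈ small U V n := by
  have key : ∀ c : Chain n X, bd n X c ∈ small U V (n - 1) →
      c - sd n X c - bdSucc n X (sdHomotopy n X c) ∈ small U V n := by
    intro c hc
    cases n with
    | zero => rw [sub_sd_zero, sub_self]; exact zero_mem _
    | succ n =>
      rw [sub_sd_succ, add_sub_cancel_left]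
      exact sdHomotopy_mem_small hc
  induction k with
  | zero => exact fun c _ hk => ⟨0, by simpa using hk⟩
  | succ k ih =>
    intro c hc hk
    -- The boundary of `sd c` must be small as well: taking the boundary in `key` shows that it
    -- differs from the boundary of `c` by a small chain.
    obtain ⟨d, hd⟩ := ih (sd n X c) (by
      have h := bd_mem_small (key c hc)
      rw [map_sub, map_sub, bd_bdSucc, sub_zero] at h
      simpa using Submodule.sub_mem _ hc h) hk
    refine ⟨d + sdHomotopy n X c, ?_⟩
    rw [map_add]
    convert Submodule.add_mem _ hd (key c hc) using 1
    abel

/-- Every chain with small boundary is small up to a boundary. -/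
theorem exists_sub_bdSucc_mem_small {U V : Set X} (hU : IsOpen U) (hV : IsOpen V)
    (hUV : U ∪ V = univ) {n : ℕ} {c : Chain n X} (hc : bd n X c ∈ small U V (n - 1)) :
    ∃ d, c - bdSucc n X d ∈ small U V n := by
  obtain ⟨k, hk⟩ := exists_iterate_sd_mem_small hU hV hUV c
  exact exists_sub_bdSucc_mem_small_of_iterate k c hc hk

/-- The inclusion of a subspace. -/
abbrev incl (U : Set X) : C(U, X) := ⟨Subtype.val, continuous_subtype_val⟩

theorem map_injective {f : C(X, Y)} (hf : Function.Injective f) (n : ℕ) :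
    Function.Injective (map f n) :=
  Finsupp.mapDomain_injective fun _ _ h =>
    ContinuousMap.ext fun t => hf (DFunLike.congr_fun h t)

theorem range_map_incl (U : Set X) (n : ℕ) : LinearMap.range (map (incl U) n) = within U n := by
  apply le_antisymm
  · rintro _ ⟨c, rfl⟩
    induction c using Finsupp.induction_linear with
    | zero => simp
    | add a b ha hb => rw [map_add]; exact Submodule.add_mem _ ha hb
    | single σ r =>
      rw [map_single]
      refine Finsupp.single_mem_supported ℝ _ ?_
      rintro _ ⟨t, rfl⟩
      exact (σ t).2
  · rw [within, Finsupp.supported_eq_span_single, Submodule.span_le]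
    rintro _ ⟨σ, hσ, rfl⟩
    refine ⟨Finsupp.single ⟨fun t => ⟨σ t, hσ ⟨t, rfl⟩⟩, by fun_prop⟩ 1, ?_⟩
    rw [map_single]
    rfl

end Chain

section

/-! ### Homology classes of singular cycles -/

namespace Chain

open AlgebraicTopology Simplicial

theorem congr_hom {M N : ModuleCat.{u} ℝ} {f g : M ⟶ N} (h : f = g) (x : M) :
    f.hom x = g.hom x := by rw [h]

/-- The coefficients. -/
abbrev coeff : ModuleCat.{u} ℝ := ModuleCat.of ℝ (ULift.{u} ℝ)

/-- The singular chain complex of Mathlib. -/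
abbrev complex (X : Type u) [TopologicalSpace X] : ChainComplex (ModuleCat.{u} ℝ) ℕ :=
  (TopCat.toSSet.obj (TopCat.of X)).chainComplex coeff

/-- The map of singular chain complexes of Mathlib induced by a continuous map. -/
abbrev complexMap {X Y : Type u} [TopologicalSpace X] [TopologicalSpace Y] (f : C(X, Y)) :
    complex X ⟶ complex Y :=
  SSet.chainComplexMap (TopCat.toSSet.map (TopCat.ofHom f)) coeff

/-- A singular simplex as a simplex of the singular simplicial set. -/
def toSimplex {X : Type u} [TopologicalSpace X] {n : ℕ} (σ : C(Spx (n + 1), X)) :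
    (TopCat.toSSet.obj (TopCat.of X)) _⦋n⦌ :=
  (TopCat.toSSetObjEquiv (TopCat.of X) (Opposite.op ⦋n⦌)).symm σ

/-- The inclusion of the summand of the singular chain complex given by a simplex. -/
abbrev simplexι {X : Type u} [TopologicalSpace X] {n : ℕ}
    (x : (TopCat.toSSet.obj (TopCat.of X)) _⦋n⦌) : coeff.{u} ⟶ (complex X).X n :=
  SSet.ιChainComplex _ x

/-- The generator of the singular chain complex given by a singular simplex. -/
def gen {X : Type u} [TopologicalSpace X] {n : ℕ} (σ : C(Spx (n + 1), X)) : (complex X).X n :=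
  (simplexι (toSimplex σ)).hom (ULift.up 1)

theorem δ_toSimplex {X : Type u} [TopologicalSpace X] {n : ℕ} (σ : C(Spx (n + 2), X))
    (i : Fin (n + 2)) : (TopCat.toSSet.obj (TopCat.of X)).δ i (toSimplex σ) =
      toSimplex (σ.comp (Spx.face i)) := rfl

/-- The comparison of singular chains with the chains of Mathlib's singular complex. -/
def toComplex (n : ℕ) (X : Type u) [TopologicalSpace X] : Chain n X →ₗ[ℝ] (complex X).X n :=
  Finsupp.linearCombination ℝ gen

theorem toComplex_single {X : Type u} [TopologicalSpace X] {n : ℕ} (σ : C(Spx (n + 1), X)) :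
    toComplex n X (Finsupp.single σ 1) = gen σ := by
  simp [toComplex]

/-- The value on a summand of the inverse of the comparison. -/
def ofSimplex {n : ℕ} {X : Type u} [TopologicalSpace X]
    (x : (TopCat.toSSet.obj (TopCat.of X)) _⦋n⦌) : coeff.{u} ⟶ ModuleCat.of ℝ (Chain n X) :=
  ModuleCat.ofHom (Finsupp.lsingle (TopCat.toSSetObjEquiv (TopCat.of X) (Opposite.op ⦋n⦌) x) ∘ₗ
    ULift.moduleEquiv.toLinearMap)

/-- The inverse of the comparison. -/
def ofComplex (n : ℕ) (X : Type u) [TopologicalSpace X] :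
    (complex X).X n ⟶ ModuleCat.of ℝ (Chain n X) :=
  ((TopCat.toSSet.obj (TopCat.of X)).isColimitChainComplexXCofan coeff n).desc
    (Limits.Cofan.mk _ ofSimplex)

theorem ι_ofComplex {n : ℕ} {X : Type u} [TopologicalSpace X]
    (x : (TopCat.toSSet.obj (TopCat.of X)) _⦋n⦌) : simplexι x ≫ ofComplex n X = ofSimplex x :=
  ((TopCat.toSSet.obj (TopCat.of X)).isColimitChainComplexXCofan coeff n).fac
    (Limits.Cofan.mk _ ofSimplex) ⟨x⟩

theorem ofComplex_gen {n : ℕ} {X : Type u} [TopologicalSpace X] (σ : C(Spx (n + 1), X)) :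
    (ofComplex n X).hom (gen σ) = Finsupp.single σ 1 := by
  refine (congr_hom (ι_ofComplex (toSimplex σ)) (ULift.up 1)).trans ?_
  simp [ofSimplex, toSimplex]

theorem ofComplex_toComplex {n : ℕ} {X : Type u} [TopologicalSpace X] (c : Chain n X) :
    (ofComplex n X).hom (toComplex n X c) = c := by
  have : (ofComplex n X).hom ∘ₗ toComplex n X = LinearMap.id := linearMap_ext fun σ => by
    rw [LinearMap.comp_apply, toComplex_single, ofComplex_gen, LinearMap.id_apply]
  exact LinearMap.congr_fun this c

theorem coeff_ext {M : ModuleCat.{u} ℝ} {f g : coeff.{u} ⟶ M}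
    (h : f.hom (ULift.up 1) = g.hom (ULift.up 1)) : f = g := by
  ext ⟨r⟩
  have : (ULift.up r : ULift.{u} ℝ) = r • ULift.up 1 := by ext; simp
  erw [this, map_smul, map_smul, h]

theorem toComplex_ofComplex {n : ℕ} {X : Type u} [TopologicalSpace X] (c : (complex X).X n) :
    toComplex n X ((ofComplex n X).hom c) = c := by
  have : ofComplex n X ≫ ModuleCat.ofHom (toComplex n X) = 𝟙 _ := by
    refine SSet.chainComplex_hom_ext fun x => ?_
    rw [← Category.assoc, Category.comp_id]
    refine coeff_ext ?_
    obtain ⟨σ, rfl⟩ : ∃ σ, x = toSimplex σ := ⟨_, (Equiv.symm_apply_apply _ x).symm⟩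
    change toComplex n X ((ofComplex n X).hom (gen σ)) = gen σ
    rw [ofComplex_gen, toComplex_single]
  exact congr_hom this c

theorem toComplex_bijective (n : ℕ) (X : Type u) [TopologicalSpace X] :
    Function.Bijective (toComplex n X) :=
  Function.bijective_iff_has_inverse.2 ⟨_, ofComplex_toComplex, toComplex_ofComplex⟩

theorem d_toComplex_succ {n : ℕ} {X : Type u} [TopologicalSpace X] (c : Chain (n + 1) X) :
    ((complex X).d (n + 1) n).hom (toComplex (n + 1) X c) = toComplex n X (bdSucc n X c) := by
  have : ((complex X).d (n + 1) n).hom ∘ₗ toComplex (n + 1) X = toComplex n X ∘ₗ bdSucc n X :=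
    linearMap_ext fun σ => by
      simp only [LinearMap.comp_apply, toComplex_single, bdSucc_single, map_sum, map_smul]
      refine (congr_hom (SSet.ιChainComplex_d (X := TopCat.toSSet.obj (TopCat.of X)) (R := coeff)
        (toSimplex σ)) (ULift.up 1)).trans ?_
      simp only [ModuleCat.hom_sum, LinearMap.sum_apply, δ_toSimplex]
      refine Finset.sum_congr rfl fun i _ => ?_
      -- The signs on the two sides are scalars of different types and are compared by parity.
      rcases Nat.even_or_odd (i : ℕ) with h | h
      · rw [h.neg_one_pow, h.neg_one_pow, one_smul, one_smul]
        rfl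
      · rw [h.neg_one_pow, h.neg_one_pow, neg_smul, neg_smul, one_smul, one_smul]
        rfl
  exact LinearMap.congr_fun this c

theorem d_toComplex {n : ℕ} {X : Type u} [TopologicalSpace X] (c : Chain n X) :
    ((complex X).d n (n - 1)).hom (toComplex n X c) = toComplex (n - 1) X (bd n X c) := by
  cases n with
  | zero =>
    exact (congr_hom ((complex X).shape 0 0 (by simp)) _).trans (map_zero (toComplex 0 X)).symm
  | succ n => exact d_toComplex_succ c

theorem map_toComplex {n : ℕ} {X Y : Type u} [TopologicalSpace X] [TopologicalSpace Y]
    (f : C(X, Y)) (c : Chain n X) :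
    ((complexMap f).f n).hom (toComplex n X c) =
      toComplex n Y (map f n c) := by
  have : ((complexMap f).f n).hom ∘ₗ
      toComplex n X = toComplex n Y ∘ₗ map f n := linearMap_ext fun σ => by
    simp only [LinearMap.comp_apply, toComplex_single, map_single]
    exact congr_hom (SSet.ι_chainComplexMap_f _ _ (TopCat.toSSet.map (TopCat.ofHom f)) coeff
      (toSimplex σ)) (ULift.up 1)
  exact LinearMap.congr_fun this c

end Chain

/-- Singular cycles. -/
abbrev Cycle (n : ℕ) (X : Type u) [TopologicalSpace X] : Type u := LinearMap.ker (Chain.bd n X)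

namespace Cycle

variable {n : ℕ} {X Y : Type u} [TopologicalSpace X] [TopologicalSpace Y]

/-- Cycles as chains of Mathlib's singular complex. -/
def toComplex (n : ℕ) (X : Type u) [TopologicalSpace X] :
    ModuleCat.of ℝ (Cycle n X) ⟶ (Chain.complex X).X n :=
  ModuleCat.ofHom (Chain.toComplex n X ∘ₗ (LinearMap.ker (Chain.bd n X)).subtype)

theorem toComplex_d (n : ℕ) (X : Type u) [TopologicalSpace X] :
    toComplex n X ≫ (Chain.complex X).d n (n - 1) = 0 :=
  ModuleCat.hom_ext <| LinearMap.ext fun z => by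
    refine (Chain.d_toComplex z.1).trans ?_
    rw [z.2, map_zero]
    rfl

/-- Cycles as elements of the cycle object of Mathlib's singular complex. -/
def toCycles (n : ℕ) (X : Type u) [TopologicalSpace X] :
    ModuleCat.of ℝ (Cycle n X) ⟶ (Chain.complex X).cycles n :=
  (Chain.complex X).liftCycles (toComplex n X) (n - 1) (by cases n <;> simp) (toComplex_d n X)

theorem iCycles_toCycles (z : Cycle n X) :
    ((Chain.complex X).iCycles n).hom ((toCycles n X).hom z) = Chain.toComplex n X z.1 :=
  Chain.congr_hom ((Chain.complex X).liftCycles_i (toComplex n X) (n - 1) (by cases n <;> simp)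
    (toComplex_d n X)) z

theorem iCycles_injective : Function.Injective ((Chain.complex X).iCycles n).hom :=
  (ModuleCat.mono_iff_injective _).1 inferInstance

/-- The homology class of a cycle. -/
def cls (n : ℕ) (X : Type u) [TopologicalSpace X] : Cycle n X →ₗ[ℝ] H (n : ℤ) X :=
  (toCycles n X ≫ (Chain.complex X).homologyπ n).hom

theorem cls_surjective : Function.Surjective (cls n X) := by
  have h : Function.Surjective ((Chain.complex X).homologyπ n).hom :=
    (ModuleCat.epi_iff_surjective _).1 inferInstance
  intro x
  obtain ⟨y, rfl⟩ := h x
  obtain ⟨c, hc⟩ := (Chain.toComplex_bijective n X).2 (((Chain.complex X).iCycles n).hom y)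
  have hz : c ∈ LinearMap.ker (Chain.bd n X) := by
    rw [LinearMap.mem_ker]
    apply (Chain.toComplex_bijective _ _).1
    rw [← Chain.d_toComplex, hc, map_zero]
    exact Chain.congr_hom ((Chain.complex X).iCycles_d n (n - 1)) y
  refine ⟨⟨c, hz⟩, congrArg ((Chain.complex X).homologyπ n).hom (iCycles_injective ?_)⟩
  exact (iCycles_toCycles ⟨c, hz⟩).trans hc

theorem cls_eq_zero_iff {z : Cycle n X} : cls n X z = 0 ↔ ∃ d, Chain.bdSucc n X d = z.1 := by
  have hex : (ShortComplex.mk ((Chain.complex X).toCycles (n + 1) n)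
      ((Chain.complex X).homologyπ n) (by simp)).Exact :=
    ShortComplex.exact_of_g_is_cokernel _
      ((Chain.complex X).homologyIsCokernel (n + 1) n (by simp))
  rw [ShortComplex.moduleCat_exact_iff] at hex
  have hi : ∀ y, ((Chain.complex X).iCycles n).hom (((Chain.complex X).toCycles (n + 1) n).hom y) =
      ((Chain.complex X).d (n + 1) n).hom y := fun y =>
    Chain.congr_hom ((Chain.complex X).toCycles_i (n + 1) n) y
  constructor
  · intro h
    obtain ⟨y, hy⟩ := hex ((toCycles n X).hom z) h
    obtain ⟨d, rfl⟩ := (Chain.toComplex_bijective (n + 1) X).2 y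
    refine ⟨d, (Chain.toComplex_bijective n X).1 ?_⟩
    rw [← Chain.d_toComplex_succ, ← iCycles_toCycles, ← hi]
    exact congrArg _ hy
  · rintro ⟨d, hd⟩
    have : (toCycles n X).hom z =
        ((Chain.complex X).toCycles (n + 1) n).hom (Chain.toComplex (n + 1) X d) := by
      apply iCycles_injective
      rw [iCycles_toCycles, hi, Chain.d_toComplex_succ, hd]
    change ((Chain.complex X).homologyπ n).hom ((toCycles n X).hom z) = 0
    rw [this]
    exact Chain.congr_hom ((Chain.complex X).toCycles_comp_homologyπ (n + 1) n) _

/-- The image of a cycle under a continuous map. -/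
def map (f : C(X, Y)) (n : ℕ) : Cycle n X →ₗ[ℝ] Cycle n Y :=
  (Chain.map f n).restrict fun c hc => by
    rw [LinearMap.mem_ker] at hc ⊢
    rw [Chain.bd_map, hc, map_zero]

@[simp]
theorem coe_map (f : C(X, Y)) (z : Cycle n X) : (map f n z).1 = Chain.map f n z.1 := rfl

theorem map_cls (f : C(X, Y)) (z : Cycle n X) : H.map n f (cls n X z) = cls n Y (map f n z) := by
  let F := Chain.complexMap f
  have h1 : (HomologicalComplex.cyclesMap F n).hom ((toCycles n X).hom z) =
      (toCycles n Y).hom (map f n z) := by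
    apply iCycles_injective
    rw [iCycles_toCycles, coe_map, ← Chain.map_toComplex, ← iCycles_toCycles]
    exact Chain.congr_hom (HomologicalComplex.cyclesMap_i F n) ((toCycles n X).hom z)
  have h2 := Chain.congr_hom (HomologicalComplex.homologyπ_naturality F n)
    ((toCycles n X).hom z)
  refine h2.trans ?_
  exact congrArg ((Chain.complex Y).homologyπ n).hom h1

end Cycle

end

section

/-! ### The Mayer-Vietoris sequence -/

/-- A kernel has a complement over a field; this is where exact sequences turn into direct sums. -/
theorem exists_equiv_ker_prod_range {P Q : Type*} [AddCommGroup P] [Module ℝ P] [AddCommGroup Q]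
    [Module ℝ Q] (δ : P →ₗ[ℝ] Q) :
    Nonempty (P ≃ₗ[ℝ] LinearMap.ker δ × LinearMap.range δ) := by
  obtain ⟨C, hC⟩ := Submodule.exists_isCompl (LinearMap.ker δ)
  exact ⟨(Submodule.prodEquivOfIsCompl _ _ hC).symm ≪≫ₗ (LinearEquiv.refl ℝ _).prodCongr
    ((Submodule.quotientEquivOfIsCompl _ _ hC).symm ≪≫ₗ δ.quotKerEquivRange)⟩

/-- The hypothesis lets `q` factor as `δ ∘ p`, and `P` splits as kernel plus range of `δ`. It is
meant for `D` the cycles split along a cover, `p` their class and `q` the class of the boundary of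
one part; then `δ` is the connecting map of Mayer-Vietoris. -/
theorem exists_equiv_of_ker_le_ker {D P Q : Type*} [AddCommGroup D] [Module ℝ D]
    [AddCommGroup P] [Module ℝ P] [AddCommGroup Q] [Module ℝ Q] {p : D →ₗ[ℝ] P} {q : D →ₗ[ℝ] Q}
    (hp : Function.Surjective p) (h : ∀ d, p d = 0 → q d = 0) :
    Nonempty (P ≃ₗ[ℝ] (LinearMap.ker q).map p × LinearMap.range q) := by
  obtain ⟨δ, hδ⟩ : ∃ δ : P →ₗ[ℝ] Q, δ ∘ₗ p = q := by
    refine ⟨(LinearMap.ker p).liftQ q (fun d hd => h d hd) ∘ₗ (p.quotKerEquivOfSurjective hp).symm.toLinearMap,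
      LinearMap.ext fun d => ?_⟩
    have : (p.quotKerEquivOfSurjective hp).symm (p d) = Submodule.Quotient.mk d := by
      rw [LinearEquiv.symm_apply_eq]
      rfl
    rw [LinearMap.comp_apply, LinearMap.comp_apply, LinearEquiv.coe_coe, this]
    rfl
  have hk : LinearMap.ker δ = (LinearMap.ker q).map p := by
    rw [← hδ, LinearMap.ker_comp, Submodule.map_comap_eq_of_surjective hp]
  have hr : LinearMap.range δ = LinearMap.range q := by
    rw [← hδ, LinearMap.range_comp, LinearMap.range_eq_top.2 hp, Submodule.map_top]
  obtain ⟨e⟩ := exists_equiv_ker_prod_range δ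
  exact ⟨e ≪≫ₗ (LinearEquiv.ofEq _ _ hk).prodCongr (LinearEquiv.ofEq _ _ hr)⟩

section MayerVietoris

variable {X : Type u} [TopologicalSpace X] {U V : Set X} {n : ℕ}

open Chain

/-- The inclusion of `U ∩ V` into `U`. -/
abbrev interLeft (U V : Set X) : C((U ∩ V : Set X), U) :=
  ⟨inclusion inter_subset_left, continuous_inclusion _⟩

/-- The inclusion of `U ∩ V` into `V`. -/
abbrev interRight (U V : Set X) : C((U ∩ V : Set X), V) :=
  ⟨inclusion inter_subset_right, continuous_inclusion _⟩

theorem interLeft_injective (U V : Set X) (n : ℕ) :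
    Function.Injective (map (interLeft U V) n) :=
  map_injective (f := interLeft U V) (inclusion_injective inter_subset_left) n

theorem map_incl_injective (U : Set X) (n : ℕ) : Function.Injective (map (incl U) n) :=
  map_injective Subtype.val_injective n

theorem map_incl_interLeft (c : Chain n (U ∩ V : Set X)) :
    map (incl U) n (map (interLeft U V) n c) = map (incl (U ∩ V)) n c := map_map _ _ c

theorem map_incl_interRight (c : Chain n (U ∩ V : Set X)) :
    map (incl V) n (map (interRight U V) n c) = map (incl (U ∩ V)) n c := map_map _ _ c

theorem exists_of_mem_small {c : Chain n X} (hc : c ∈ small U V n) :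
    ∃ (a : Chain n U) (b : Chain n V), map (incl U) n a + map (incl V) n b = c := by
  rw [← within_sup_within, ← range_map_incl, ← range_map_incl] at hc
  obtain ⟨_, ⟨a, rfl⟩, _, ⟨b, rfl⟩, h⟩ := Submodule.mem_sup.1 hc
  exact ⟨a, b, h⟩

theorem mem_small_of_eq (a : Chain n U) (b : Chain n V) :
    map (incl U) n a + map (incl V) n b ∈ small U V n := by
  rw [← within_sup_within, ← range_map_incl, ← range_map_incl]
  exact Submodule.add_mem_sup ⟨a, rfl⟩ ⟨b, rfl⟩

/-- The simplices of the common image lie in `U` and in `V`, hence in `U ∩ V`. -/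
theorem exists_inter {a : Chain n U} {b : Chain n V}
    (h : map (incl U) n a = map (incl V) n b) :
    ∃ e : Chain n (U ∩ V : Set X), map (interLeft U V) n e = a ∧ map (interRight U V) n e = b := by
  have : map (incl U) n a ∈ within (U ∩ V) n := by
    rw [← within_inf_within, ← range_map_incl, ← range_map_incl]
    exact ⟨⟨a, rfl⟩, ⟨b, h.symm⟩⟩
  rw [← range_map_incl] at this
  obtain ⟨e, he⟩ := this
  refine ⟨e, map_incl_injective U n ?_, map_incl_injective V n ?_⟩
  · rw [map_incl_interLeft, he]
  · rw [map_incl_interRight, he, h]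

theorem bd_injective_of_map {Y Z : Type*} [TopologicalSpace Y] [TopologicalSpace Z] {f : C(Y, Z)}
    (hf : Function.Injective f) {c : Chain n Y} (h : bd n Z (map f n c) = 0) : bd n Y c = 0 := by
  rw [bd_map] at h
  exact map_injective hf _ (h.trans (map_zero _).symm)

/-- Two chains in `U` and `V` that form a relation up to a boundary can be corrected so that the
boundary lies in the cover. -/
theorem exists_small_of_bdSucc_eq (hU : IsOpen U) (hV : IsOpen V) (hUV : U ∪ V = univ)
    {a : Chain n U} {b : Chain n V} {c : Chain (n + 1) X}
    (h : bdSucc n X c = map (incl U) n a + map (incl V) n b) :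
    ∃ (a' : Chain (n + 1) U) (b' : Chain (n + 1) V) (e : Chain n (U ∩ V : Set X)),
      map (interLeft U V) n e = a - bdSucc n U a' ∧
        map (interRight U V) n e = bdSucc n V b' - b := by
  obtain ⟨d, hd⟩ := exists_sub_bdSucc_mem_small hU hV hUV (n := n + 1) (c := c)
    (by change bdSucc n X c ∈ small U V n; rw [h]; exact mem_small_of_eq a b)
  obtain ⟨a', b', hab⟩ := exists_of_mem_small hd
  obtain ⟨e, he⟩ := exists_inter (a := a - bdSucc n U a') (b := bdSucc n V b' - b) (by
    have h2 := congrArg (bdSucc n X) hab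
    rw [map_add, map_sub, bdSucc_bdSucc, sub_zero, h, bdSucc_map, bdSucc_map] at h2
    rw [map_sub, map_sub, sub_eq_sub_iff_add_eq_add, add_comm (map (incl V) n _), h2])
  exact ⟨a', b', e, he⟩

theorem cls_eq_cls {Y : Type u} [TopologicalSpace Y] {z w : Cycle n Y} {d : Chain (n + 1) Y}
    (h : bdSucc n Y d = z.1 - w.1) : Cycle.cls n Y z = Cycle.cls n Y w := by
  rw [← sub_eq_zero, ← map_sub]
  exact Cycle.cls_eq_zero_iff.2 ⟨d, h⟩

/-- Exactness at the sum of the two pieces. A chain bounding `a + b` may be taken small and split as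
`a' + b'`; then `a - ∂a' = ∂b' - b` lives in `U ∩ V`. The sign of `y` reflects the use of the sum,
rather than the difference, of the two inclusions. -/
theorem mayerVietoris_exact (hU : IsOpen U) (hV : IsOpen V) (hUV : U ∪ V = univ)
    {x : H (n : ℤ) U} {y : H (n : ℤ) V}
    (h : H.map n (incl U) x + H.map n (incl V) y = 0) :
    ∃ e : H (n : ℤ) (U ∩ V : Set X),
      H.map n (interLeft U V) e = x ∧ H.map n (interRight U V) e = -y := by
  obtain ⟨a, rfl⟩ := Cycle.cls_surjective x
  obtain ⟨b, rfl⟩ := Cycle.cls_surjective y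
  rw [Cycle.map_cls, Cycle.map_cls, ← map_add, Cycle.cls_eq_zero_iff] at h
  obtain ⟨c, hc⟩ := h
  obtain ⟨a', b', e, he1, he2⟩ := exists_small_of_bdSucc_eq hU hV hUV
    (a := a.1) (b := b.1) hc
  have he : e ∈ LinearMap.ker (bd n (U ∩ V : Set X)) := by
    refine bd_injective_of_map (f := interLeft U V)
      (inclusion_injective inter_subset_left) ?_
    rw [he1, map_sub, bd_bdSucc, sub_zero]
    exact a.2
  refine ⟨Cycle.cls _ _ ⟨e, he⟩, ?_, ?_⟩
  · rw [Cycle.map_cls]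
    refine cls_eq_cls (d := -a') ?_
    rw [Cycle.coe_map, he1, map_neg]
    abel
  · rw [Cycle.map_cls, ← map_neg]
    refine cls_eq_cls (d := b') ?_
    rw [Cycle.coe_map, he2, Submodule.coe_neg]
    abel

/-- A small cycle splits into parts in `U` and `V` whose boundaries cancel; by disjointness each of
them is zero. The argument includes degree zero. -/
theorem mayerVietoris_surjective (hU : IsOpen U) (hV : IsOpen V) (hUV : U ∪ V = univ)
    (hd : U ∩ V = ∅) (x : H (n : ℤ) X) :
    ∃ (y : H (n : ℤ) U) (z : H (n : ℤ) V), H.map n (incl U) y + H.map n (incl V) z = x := by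
  obtain ⟨c, rfl⟩ := Cycle.cls_surjective x
  obtain ⟨d, hd'⟩ := exists_sub_bdSucc_mem_small hU hV hUV (n := n) (c := c.1)
    (by rw [c.2]; exact zero_mem _)
  obtain ⟨a, b, hab⟩ := exists_of_mem_small hd'
  have hsum : map (incl U) _ (bd n U a) = map (incl V) _ (-bd n V b) := by
    rw [map_neg, eq_neg_iff_add_eq_zero, ← bd_map, ← bd_map, ← map_add, hab, map_sub, bd_bdSucc,
      sub_zero]
    exact c.2
  obtain ⟨e, he1, he2⟩ := exists_inter hsum
  have : IsEmpty (U ∩ V : Set X) := by rw [hd]; infer_instance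
  have : IsEmpty C(Spx (n - 1 + 1), (U ∩ V : Set X)) :=
    ⟨fun σ => isEmptyElim (σ (Spx.vertex _ 0))⟩
  have he0 : e = 0 := Subsingleton.elim _ _
  rw [he0, map_zero] at he1 he2
  refine ⟨Cycle.cls _ _ ⟨a, he1.symm⟩, Cycle.cls _ _ ⟨b, by
    rw [LinearMap.mem_ker, ← neg_eq_zero]; exact he2.symm⟩, ?_⟩
  rw [Cycle.map_cls, Cycle.map_cls, ← map_add]
  refine cls_eq_cls (d := -d) ?_
  rw [Submodule.coe_add, Cycle.coe_map, Cycle.coe_map, hab, map_neg]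
  abel

/-- The boundary of the sum of a chain in `U` and a chain in `V`. -/
def sumBd (U V : Set X) (n : ℕ) : Chain (n + 1) U × Chain (n + 1) V →ₗ[ℝ] Chain n X :=
  bdSucc n X ∘ₗ (map (incl U) (n + 1)).coprod (map (incl V) (n + 1))

/-- Pairs of a chain in `U` and a chain in `V` whose sum is a cycle. -/
def SumCycle (U V : Set X) (n : ℕ) : Type u := LinearMap.ker (sumBd U V n)

instance (U V : Set X) (n : ℕ) : AddCommGroup (SumCycle U V n) :=
  inferInstanceAs (AddCommGroup (LinearMap.ker (sumBd U V n)))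

instance (U V : Set X) (n : ℕ) : Module ℝ (SumCycle U V n) :=
  inferInstanceAs (Module ℝ (LinearMap.ker (sumBd U V n)))

/-- The underlying pair of chains. -/
def SumCycle.val (U V : Set X) (n : ℕ) :
    SumCycle U V n →ₗ[ℝ] Chain (n + 1) U × Chain (n + 1) V :=
  (LinearMap.ker (sumBd U V n)).subtype

/-- The class of a cycle that is the sum of a chain in `U` and a chain in `V`. -/
def sumCls (U V : Set X) (n : ℕ) : SumCycle U V n →ₗ[ℝ] H ((n + 1 : ℕ) : ℤ) X :=
  Cycle.cls (n + 1) X ∘ₗ LinearMap.codRestrict (LinearMap.ker (bd (n + 1) X))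
    ((map (incl U) (n + 1)).coprod (map (incl V) (n + 1)) ∘ₗ SumCycle.val U V n) fun z => z.2

theorem sumBd_eq (z : SumCycle U V n) :
    map (incl U) n (bdSucc n U z.1.1) = map (incl V) n (-bdSucc n V z.1.2) := by
  have h : bdSucc n X (map (incl U) (n + 1) z.1.1 + map (incl V) (n + 1) z.1.2) = 0 := z.2
  rw [map_add, bdSucc_map, bdSucc_map] at h
  rw [map_neg]
  exact eq_neg_of_add_eq_zero_left h

/-- The boundary of the part in `U` of a cycle in the cover, as a chain in `U ∩ V`. -/
def interBd (U V : Set X) (n : ℕ) :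
    SumCycle U V n →ₗ[ℝ] Chain n (U ∩ V : Set X) :=
  (LinearEquiv.ofInjective (map (interLeft U V) n)
    (interLeft_injective U V n)).symm.toLinearMap ∘ₗ
    (bdSucc n U ∘ₗ LinearMap.fst ℝ _ _ ∘ₗ SumCycle.val U V n).codRestrict
      (LinearMap.range (map (interLeft U V) n)) fun z => by
        obtain ⟨e, he, -⟩ := exists_inter (sumBd_eq z)
        exact ⟨e, he⟩

theorem interLeft_interBd (z : SumCycle U V n) :
    map (interLeft U V) n (interBd U V n z) = bdSucc n U z.1.1 :=
  LinearEquiv.ofInjective_symm_apply (h := interLeft_injective U V n) _ _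

theorem interRight_interBd (z : SumCycle U V n) :
    map (interRight U V) n (interBd U V n z) = -bdSucc n V z.1.2 := by
  apply map_incl_injective V n
  rw [map_incl_interRight, ← map_incl_interLeft, interLeft_interBd, sumBd_eq]

/-- The class in `U ∩ V` of the boundary of the part in `U` of a cycle. -/
def interCls (U V : Set X) (n : ℕ) :
    SumCycle U V n →ₗ[ℝ] H (n : ℤ) (U ∩ V : Set X) :=
  Cycle.cls n _ ∘ₗ (interBd U V n).codRestrict (LinearMap.ker (bd n _)) fun z => by
    refine bd_injective_of_map (f := interLeft U V)
      (inclusion_injective inter_subset_left) ?_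
    rw [interLeft_interBd, bd_bdSucc]

theorem interCls_eq_zero_iff {z : SumCycle U V n} :
    interCls U V n z = 0 ↔ ∃ e, bdSucc n _ e = interBd U V n z := Cycle.cls_eq_zero_iff

theorem sumCls_eq (z : SumCycle U V n) {a : Cycle (n + 1) U} {b : Cycle (n + 1) V}
    (h : map (incl U) (n + 1) z.1.1 + map (incl V) (n + 1) z.1.2 =
      map (incl U) (n + 1) a.1 + map (incl V) (n + 1) b.1) :
    sumCls U V n z = H.map ((n + 1 : ℕ) : ℤ) (incl U) (Cycle.cls (n + 1) U a) +
      H.map ((n + 1 : ℕ) : ℤ) (incl V) (Cycle.cls (n + 1) V b) := by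
  rw [Cycle.map_cls, Cycle.map_cls, ← map_add]
  exact congrArg (Cycle.cls (n + 1) X) (Subtype.ext h)

theorem sumCls_surjective (hU : IsOpen U) (hV : IsOpen V) (hUV : U ∪ V = univ) :
    Function.Surjective (sumCls U V n) := by
  intro x
  obtain ⟨c, rfl⟩ := Cycle.cls_surjective x
  obtain ⟨d, hd⟩ := exists_sub_bdSucc_mem_small hU hV hUV (n := n + 1) (c := c.1)
    (by rw [c.2]; exact zero_mem _)
  obtain ⟨a, b, hab⟩ := exists_of_mem_small hd
  refine ⟨⟨(a, b), ?_⟩, cls_eq_cls (d := -d) ?_⟩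
  · change bdSucc n X (map (incl U) (n + 1) a + map (incl V) (n + 1) b) = 0
    rw [hab, map_sub, bdSucc_bdSucc, sub_zero]
    exact c.2
  · change bdSucc (n + 1) X (-d) = map (incl U) (n + 1) a + map (incl V) (n + 1) b - c.1
    rw [hab, map_neg]
    abel

/-- The connecting map is well defined: if the sum bounds, then `∂a` is the boundary of `a - ∂a'`,
which is a chain in `U ∩ V`. -/
theorem interCls_eq_zero_of_sumCls_eq_zero (hU : IsOpen U) (hV : IsOpen V)
    (hUV : U ∪ V = univ) (z : SumCycle U V n) (hz : sumCls U V n z = 0) :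
    interCls U V n z = 0 := by
  obtain ⟨c, hc⟩ := Cycle.cls_eq_zero_iff.1 hz
  obtain ⟨a', b', e, he, -⟩ := exists_small_of_bdSucc_eq hU hV hUV (a := z.1.1) (b := z.1.2) hc
  refine Cycle.cls_eq_zero_iff.2 ⟨e, ?_⟩
  apply interLeft_injective U V
  change _ = map (interLeft U V) n (interBd U V n z)
  rw [interLeft_interBd, ← bdSucc_map, he, map_sub, bdSucc_bdSucc, sub_zero]

/-- Exactness at `H_n(U ∩ V)`: the range of the connecting map. -/
theorem range_interCls : LinearMap.range (interCls U V n) =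
    LinearMap.ker (H.map n (interLeft U V)) ⊓ LinearMap.ker (H.map n (interRight U V)) := by
  apply le_antisymm
  · rintro _ ⟨z, rfl⟩
    constructor
    · refine (Cycle.map_cls _ _).trans (Cycle.cls_eq_zero_iff.2 ⟨z.1.1, ?_⟩)
      exact (interLeft_interBd z).symm
    · refine (Cycle.map_cls _ _).trans (Cycle.cls_eq_zero_iff.2 ⟨-z.1.2, ?_⟩)
      rw [map_neg]
      exact (interRight_interBd z).symm
  · rintro x ⟨h1, h2⟩
    obtain ⟨e, rfl⟩ := Cycle.cls_surjective x
    obtain ⟨a, ha⟩ := Cycle.cls_eq_zero_iff.1 ((Cycle.map_cls _ _).symm.trans h1)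
    obtain ⟨b, hb⟩ := Cycle.cls_eq_zero_iff.1 ((Cycle.map_cls _ _).symm.trans h2)
    -- The cycle `e` bounds `a` in `U` and `b` in `V`, so `a - b` is a cycle of `X` that the
    -- connecting map sends to the class of `e`.
    have hz : (a, -b) ∈ LinearMap.ker (sumBd U V n) := by
      change bdSucc n X (map (incl U) (n + 1) a + map (incl V) (n + 1) (-b)) = 0
      rw [map_add, bdSucc_map, bdSucc_map, map_neg, ha, hb, map_neg, Cycle.coe_map, Cycle.coe_map,
        map_incl_interLeft, map_incl_interRight, add_neg_cancel]
    refine ⟨⟨(a, -b), hz⟩, congrArg (Cycle.cls n _) (Subtype.ext ?_)⟩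
    apply interLeft_injective U V
    exact (interLeft_interBd _).trans ha

/-- Exactness at `H_{n+1}(X)`: the kernel of the connecting map. -/
theorem map_ker_interCls : (LinearMap.ker (interCls U V n)).map (sumCls U V n) =
    LinearMap.range ((H.map ((n + 1 : ℕ) : ℤ) (incl U)).coprod
      (H.map ((n + 1 : ℕ) : ℤ) (incl V))) := by
  apply le_antisymm
  · rintro _ ⟨z, hz, rfl⟩
    obtain ⟨e, he⟩ := interCls_eq_zero_iff.1 hz
    -- Moving `e` from one part to the other leaves the sum unchanged and turns both parts into
    -- cycles.
    have ha : z.1.1 - map (interLeft U V) (n + 1) e ∈ LinearMap.ker (bd (n + 1) U) := by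
      change bdSucc n U _ = 0
      rw [map_sub, bdSucc_map, he, interLeft_interBd, sub_self]
    have hb : z.1.2 + map (interRight U V) (n + 1) e ∈ LinearMap.ker (bd (n + 1) V) := by
      change bdSucc n V _ = 0
      rw [map_add, bdSucc_map, he, interRight_interBd, add_neg_cancel]
    rw [sumCls_eq (a := ⟨_, ha⟩) (b := ⟨_, hb⟩) z (by
      rw [map_sub, map_add, map_incl_interLeft, map_incl_interRight]
      abel)]
    exact ⟨(_, _), LinearMap.coprod_apply _ _ _⟩
  · rintro _ ⟨⟨x, y⟩, rfl⟩
    obtain ⟨a, rfl⟩ := Cycle.cls_surjective x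
    obtain ⟨b, rfl⟩ := Cycle.cls_surjective y
    have ha : bdSucc n U a.1 = 0 := a.2
    have hb : bdSucc n V b.1 = 0 := b.2
    have hz : (a.1, b.1) ∈ LinearMap.ker (sumBd U V n) := by
      change bdSucc n X (map (incl U) (n + 1) a.1 + map (incl V) (n + 1) b.1) = 0
      rw [map_add, bdSucc_map, bdSucc_map, ha, hb, map_zero, map_zero, add_zero]
    have h0 : interBd U V n ⟨_, hz⟩ = 0 := by
      apply interLeft_injective U V
      rw [map_zero]
      exact (interLeft_interBd _).trans ha
    rw [LinearMap.coprod_apply, ← sumCls_eq ⟨_, hz⟩ rfl]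
    refine Submodule.mem_map_of_mem (LinearMap.mem_ker.2 ?_)
    exact interCls_eq_zero_iff.2 ⟨0, (map_zero _).trans h0.symm⟩

/-- The homology of a space covered by two open sets. -/
theorem mayerVietoris_equiv (hU : IsOpen U) (hV : IsOpen V) (hUV : U ∪ V = univ) (n : ℕ) :
    Nonempty (H ((n + 1 : ℕ) : ℤ) X ≃ₗ[ℝ]
      LinearMap.range ((H.map ((n + 1 : ℕ) : ℤ) (incl U)).coprod
        (H.map ((n + 1 : ℕ) : ℤ) (incl V))) ×
      (LinearMap.ker (H.map n (interLeft U V)) ⊓ LinearMap.ker (H.map n (interRight U V)) :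
        Submodule ℝ (H (n : ℤ) (U ∩ V : Set X)))) := by
  rw [← map_ker_interCls, ← range_interCls]
  exact exists_equiv_of_ker_le_ker (p := sumCls U V n) (q := interCls U V n)
    (sumCls_surjective hU hV hUV) (interCls_eq_zero_of_sumCls_eq_zero hU hV hUV)

end MayerVietoris

end

/-! ### Formal properties of homology -/

section Functoriality

variable {X Y Z : Type u} [TopologicalSpace X] [TopologicalSpace Y] [TopologicalSpace Z]

theorem H.map_id_apply (n : ℤ) (x : H n X) : H.map n (ContinuousMap.id X) x = x :=
  congrArg (fun f => f.hom x) ((homology n).map_id (TopCat.of X))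

theorem H.map_map (n : ℤ) (g : C(Y, Z)) (f : C(X, Y)) (x : H n X) :
    H.map n g (H.map n f x) = H.map n (g.comp f) x :=
  (congrArg (fun f => f.hom x) ((homology n).map_comp (TopCat.ofHom f) (TopCat.ofHom g))).symm

theorem subsingleton_H_of_neg {n : ℤ} (hn : n < 0) (X : Type u) [TopologicalSpace X] :
    Subsingleton (H n X) := by
  cases n with
  | ofNat n => exact absurd hn (by simp)
  | negSucc n => exact inferInstanceAs (Subsingleton PUnit)

theorem H.map_eq_of_homotopic (n : ℤ) {f g : C(X, Y)} (h : f.Homotopic g) :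
    H.map n f = H.map n g := by
  obtain ⟨F⟩ := h
  cases n with
  | ofNat n =>
    have := TopCat.Homotopy.congr_homologyMap_singularChainComplexFunctor
      (f := TopCat.ofHom f) (g := TopCat.ofHom g) F (ModuleCat.of ℝ (ULift.{u} ℝ)) n
    exact congrArg ModuleCat.Hom.hom this
  | negSucc n => rfl

theorem H.map_bijective_of_homotopic (n : ℤ) {f : C(X, Y)} {g : C(Y, X)}
    (h : (g.comp f).Homotopic (ContinuousMap.id X)) (h' : (f.comp g).Homotopic (ContinuousMap.id Y)) :
    Function.Bijective (H.map n f) := by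
  refine Function.bijective_iff_has_inverse.2 ⟨H.map n g, fun x => ?_, fun y => ?_⟩
  · rw [H.map_map, H.map_eq_of_homotopic n h, H.map_id_apply]
  · rw [H.map_map, H.map_eq_of_homotopic n h', H.map_id_apply]

theorem H.map_homeomorph_bijective (n : ℤ) (e : X ≃ₜ Y) :
    Function.Bijective (H.map n (e : C(X, Y))) := by
  refine H.map_bijective_of_homotopic n (g := (e.symm : C(Y, X))) ?_ ?_
  · rw [show (e.symm : C(Y, X)).comp (e : C(X, Y)) = ContinuousMap.id X from
      ContinuousMap.ext e.symm_apply_apply]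
  · rw [show (e : C(X, Y)).comp (e.symm : C(Y, X)) = ContinuousMap.id Y from
      ContinuousMap.ext e.apply_symm_apply]

theorem subsingleton_H_of_isEmpty (n : ℕ) (X : Type u) [TopologicalSpace X] [IsEmpty X] :
    Subsingleton (H (n : ℤ) X) := by
  have : IsEmpty C(Spx (n + 1), X) := ⟨fun σ => isEmptyElim (σ (Spx.vertex _ 0))⟩
  have : Subsingleton (Cycle n X) := ⟨fun a b => Subtype.ext (Subsingleton.elim a.1 b.1)⟩
  exact Cycle.cls_surjective.subsingleton

theorem subsingleton_H_point {n : ℤ} (hn : 0 < n) : Subsingleton (H n PUnit.{u + 1}) := by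
  cases n with
  | ofNat n =>
    have hn : n ≠ 0 := by rintro rfl; exact lt_irrefl _ hn
    have : TotallyDisconnectedSpace (TopCat.of PUnit.{u + 1}) :=
      inferInstanceAs (TotallyDisconnectedSpace PUnit.{u + 1})
    exact ModuleCat.subsingleton_of_isZero
      (AlgebraicTopology.isZero_singularHomologyFunctor_of_totallyDisconnectedSpace
        (ModuleCat.{u} ℝ) n (ModuleCat.of ℝ (ULift.{u} ℝ)) (TopCat.of PUnit.{u + 1}) hn)
  | negSucc n => exact absurd hn (by simp)

/-- The map to a point. -/
abbrev toPoint (X : Type u) [TopologicalSpace X] : C(X, PUnit.{u + 1}) :=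
  ContinuousMap.const X PUnit.unit

theorem exists_equiv_H_zero [PathConnectedSpace X] : Nonempty (H 0 X ≃ₗ[ℝ] ULift.{u} ℝ) := by
  have : PathConnectedSpace (TopCat.of X) := inferInstanceAs (PathConnectedSpace X)
  exact ⟨(asIso ((TopCat.of X).singularHomology₀ε (ModuleCat.of ℝ (ULift.{u} ℝ)))).toLinearEquiv⟩

/-- Both sides are one-dimensional, and the inclusion of any point shows that the map is onto. -/
theorem H.map_zero_toPoint_injective [PathConnectedSpace X] :
    Function.Injective (H.map 0 (toPoint X)) := by
  obtain ⟨e⟩ := exists_equiv_H_zero (X := X)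
  obtain ⟨e'⟩ := exists_equiv_H_zero (X := PUnit.{u + 1})
  have : FiniteDimensional ℝ (H 0 X) := e.symm.finiteDimensional
  have : FiniteDimensional ℝ (H 0 PUnit.{u + 1}) := e'.symm.finiteDimensional
  refine (LinearMap.injective_iff_surjective_of_finrank_eq_finrank
    (e.finrank_eq.trans e'.finrank_eq.symm)).2 fun y => ?_
  obtain ⟨x⟩ : Nonempty X := inferInstance
  refine ⟨H.map 0 (ContinuousMap.const _ x) y, ?_⟩
  rw [H.map_map, show (toPoint X).comp (ContinuousMap.const _ x) = ContinuousMap.id _ from rfl,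
    H.map_id_apply]

/-- The identity of the homology factors through the homology of the point. -/
theorem H.map_toPoint_injective_of_homotopic (n : ℤ) {x : X}
    (h : (ContinuousMap.id X).Homotopic (ContinuousMap.const X x)) :
    Function.Injective (H.map n (toPoint X)) := by
  rw [injective_iff_map_eq_zero]
  intro y hy
  rw [← H.map_id_apply n y, H.map_eq_of_homotopic n h,
    show ContinuousMap.const X x = (ContinuousMap.const PUnit x).comp (toPoint X) from rfl,
    ← H.map_map, hy, map_zero]

theorem subsingleton_reducedH_of_nonpos {n : ℤ} (hn : n ≤ 0) (X : Type u) [TopologicalSpace X]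
    [PathConnectedSpace X] : Subsingleton (reducedH n X) := by
  rcases hn.lt_or_eq with h | rfl
  · have := subsingleton_H_of_neg h X
    infer_instance
  · rw [Submodule.subsingleton_iff_eq_bot, LinearMap.ker_eq_bot]
    exact H.map_zero_toPoint_injective

theorem exists_equiv_reducedH_of_pos {n : ℤ} (hn : 0 < n) (X : Type u) [TopologicalSpace X] :
    Nonempty (reducedH n X ≃ₗ[ℝ] H n X) := by
  have := subsingleton_H_point.{u} hn
  have h : LinearMap.ker (H.map n (toPoint X)) = ⊤ :=
    LinearMap.ker_eq_top.2 (LinearMap.ext fun _ => Subsingleton.elim _ _)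
  exact ⟨LinearEquiv.ofEq _ _ h ≪≫ₗ Submodule.topEquiv⟩

end Functoriality

/-! ### Disjoint unions -/

theorem H.coprod_bijective_of_disjoint {X : Type u} [TopologicalSpace X] {U V : Set X}
    (hU : IsOpen U) (hV : IsOpen V) (hUV : U ∪ V = univ) (hd : U ∩ V = ∅) (n : ℕ) :
    Function.Bijective ((H.map n (Chain.incl U)).coprod (H.map n (Chain.incl V))) := by
  constructor
  · rw [injective_iff_map_eq_zero]
    rintro ⟨x, y⟩ h
    have : IsEmpty (U ∩ V : Set X) := by rw [hd]; infer_instance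
    have := subsingleton_H_of_isEmpty n (U ∩ V : Set X)
    obtain ⟨e, rfl, he⟩ := mayerVietoris_exact hU hV hUV h
    rw [Subsingleton.elim e 0, map_zero] at he ⊢
    exact Prod.ext rfl (zero_eq_neg.1 he)
  · intro x
    obtain ⟨y, z, h⟩ := mayerVietoris_surjective hU hV hUV hd x
    exact ⟨(y, z), h⟩

/-! ### The homology of mapping cones -/

open Topology unitInterval

namespace MappingCone

variable {W M : Type u} {g : W → M}

/-- The inclusion of the target. -/
def inTarget (g : W → M) (m : M) : MappingCone g := Quot.mk _ (Sum.inl m)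

/-- The map from the cylinder. -/
def inCyl (g : W → M) (a : W × I) : MappingCone g := Quot.mk _ (Sum.inr (Quot.mk _ a))

theorem inCyl_zero (w : W) : inCyl g (w, 0) = inTarget g (g w) :=
  (Quot.sound ⟨w, rfl, rfl⟩).symm

theorem inCyl_one (w w' : W) : inCyl g (w, 1) = inCyl g (w', 1) :=
  congrArg (fun c => Quot.mk _ (Sum.inr c)) (Quot.sound ⟨rfl, rfl⟩)

theorem ind {P : MappingCone g → Prop} (hm : ∀ m, P (inTarget g m)) (hc : ∀ w t, P (inCyl g (w, t)))
    (x : MappingCone g) : P x := by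
  induction x using Quot.ind with | mk x =>
  rcases x with m | c
  · exact hm m
  · induction c using Quot.ind with | mk a => exact hc a.1 a.2

/-- Functions out of the mapping cone. -/
def lift {Z : Type*} (fm : M → Z) (fc : W × I → Z) (h0 : ∀ w, fc (w, 0) = fm (g w))
    (h1 : ∀ w w', fc (w, 1) = fc (w', 1)) : MappingCone g → Z :=
  Quot.lift (Sum.elim fm (Quot.lift fc (by
    rintro ⟨w, t⟩ ⟨w', t'⟩ ⟨h, h'⟩
    obtain rfl : t = 1 := h
    obtain rfl : t' = 1 := h'
    exact h1 w w'))) (by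
    rintro _ _ ⟨w, rfl, rfl⟩
    exact (h0 w).symm)

/-- The cone coordinate; it is zero on the target. -/
def height : MappingCone g → ℝ := lift (fun _ => 0) (fun a => a.2) (fun _ => rfl) fun _ _ => rfl

/-- The complement of the cone point. -/
def lower (g : W → M) : Set (MappingCone g) := {x | height x < 1}

/-- The open cone. -/
def upper (g : W → M) : Set (MappingCone g) := {x | 0 < height x}

theorem lower_union_upper : lower g ∪ upper g = univ := by
  refine eq_univ_of_forall fun x => ?_
  rcases lt_or_ge (height x) 1 with h | h
  · exact Or.inl h
  · exact Or.inr (zero_lt_one.trans_le h)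

theorem inCyl_mem_lower {w : W} {t : I} : inCyl g (w, t) ∈ lower g ↔ t ≠ 1 :=
  unitInterval.lt_one_iff_ne_one (x := t)

theorem inCyl_mem_upper {w : W} {t : I} : inCyl g (w, t) ∈ upper g ↔ t ≠ 0 :=
  unitInterval.pos_iff_ne_zero (x := t)

theorem inTarget_mem_lower (m : M) : inTarget g m ∈ lower g := zero_lt_one (α := ℝ)

theorem inTarget_notMem_upper (m : M) : inTarget g m ∉ upper g := lt_irrefl (0 : ℝ)

open Classical in
/-- The deformation of the complement of the cone point into the target. -/
def push (x : MappingCone g) : I → MappingCone g :=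
  lift (fun m _ => inTarget g m)
    -- At the apex the formula `σ s * t` would depend on `w`. Keeping the apex fixed makes the
    -- function well defined on the quotient; continuity is only claimed on `lower`.
    (fun a s => if a.2 = 1 then inCyl g a else inCyl g (a.1, σ s * a.2))
    (fun w => by ext s; simp [inCyl_zero])
    (fun w w' => by ext s; simp [inCyl_one w w']) x

theorem push_inCyl {w : W} {t : I} (ht : t ≠ 1) (s : I) :
    push (inCyl g (w, t)) s = inCyl g (w, σ s * t) := if_neg ht

theorem push_mem_lower {x : MappingCone g} (hx : x ∈ lower g) (s : I) : push x s ∈ lower g := by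
  induction x using ind with
  | hm m => exact hx
  | hc w t =>
    rw [push_inCyl (inCyl_mem_lower.1 hx)]
    have h : (t : ℝ) < 1 := hx
    exact (mul_le_of_le_one_left t.2.1 (σ s).2.2).trans_lt h

open Classical in
/-- The contraction of the open cone onto the cone point. -/
def contract (x : MappingCone g) : I → MappingCone g :=
  lift (fun m _ => inTarget g m)
    (fun a s => if a.2 = 0 then inCyl g a else inCyl g (a.1, σ (σ s * σ a.2)))
    (fun w => by ext s; simp [inCyl_zero])
    (fun w w' => by ext s; simp [inCyl_one w w']) x

theorem contract_inCyl {w : W} {t : I} (ht : t ≠ 0) (s : I) :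
    contract (inCyl g (w, t)) s = inCyl g (w, σ (σ s * σ t)) := if_neg ht

theorem contract_mem_upper {x : MappingCone g} (hx : x ∈ upper g) (s : I) :
    contract x s ∈ upper g := by
  induction x using ind with
  | hm m => exact hx
  | hc w t =>
    rw [contract_inCyl (inCyl_mem_upper.1 hx)]
    have h : 0 < (t : ℝ) := hx
    have h2 : (σ s * σ t : ℝ) ≤ 1 - t := mul_le_of_le_one_left (σ t).2.1 (σ s).2.2
    change (0 : ℝ) < 1 - σ s * σ t
    linarith

/-- The middle of the cylinder. -/
def half : I := ⟨1 / 2, by norm_num, by norm_num⟩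

theorem half_ne_zero : half ≠ 0 := fun h => by
  have := congrArg Subtype.val h
  norm_num [half] at this

theorem half_ne_one : half ≠ 1 := fun h => by
  have := congrArg Subtype.val h
  norm_num [half] at this

/-- The linear motion of a point of the interval to the middle. -/
def toHalf (t s : I) : I :=
  ⟨(1 - s) * t + s * (1 / 2), by
    have := s.2.1; have := s.2.2; have := t.2.1; have := t.2.2
    constructor <;> nlinarith⟩

theorem toHalf_zero (t : I) : toHalf t 0 = t := Subtype.ext (by simp [toHalf])

theorem toHalf_one (t : I) : toHalf t 1 = half := Subtype.ext (by simp [toHalf, half])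

theorem toHalf_ne_zero {t : I} (ht : t ≠ 0) (s : I) : toHalf t s ≠ 0 := fun h => by
  have h1 : (1 - s : ℝ) * t + s * (1 / 2) = 0 := congrArg Subtype.val h
  have h2 : 0 < (t : ℝ) := unitInterval.pos_iff_ne_zero.2 ht
  have := s.2.1; have := s.2.2
  rcases eq_or_ne (s : ℝ) 1 with h3 | h3
  · rw [h3] at h1; norm_num at h1
  · have : 0 < 1 - (s : ℝ) := by
      have := lt_of_le_of_ne s.2.2 h3
      linarith
    have := mul_pos this h2
    linarith

theorem toHalf_ne_one {t : I} (ht : t ≠ 1) (s : I) : toHalf t s ≠ 1 := fun h => by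
  have h1 : (1 - s : ℝ) * t + s * (1 / 2) = 1 := congrArg Subtype.val h
  have h2 : (t : ℝ) < 1 := unitInterval.lt_one_iff_ne_one.2 ht
  have := s.2.1; have := s.2.2
  rcases eq_or_ne (s : ℝ) 1 with h3 | h3
  · rw [h3] at h1; norm_num at h1
  · have : 0 < 1 - (s : ℝ) := by
      have := lt_of_le_of_ne s.2.2 h3
      linarith
    nlinarith [mul_pos this (sub_pos.2 h2)]

open Classical in
/-- The deformation of the open cylinder to its middle. -/
def center (x : MappingCone g) : I → MappingCone g :=
  lift (fun m _ => inTarget g m)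
    (fun a s => if a.2 = 0 ∨ a.2 = 1 then inCyl g a else inCyl g (a.1, toHalf a.2 s))
    (fun w => by ext s; simp [inCyl_zero])
    (fun w w' => by ext s; simp [inCyl_one w w']) x

theorem center_inCyl {w : W} {t : I} (h0 : t ≠ 0) (h1 : t ≠ 1) (s : I) :
    center (inCyl g (w, t)) s = inCyl g (w, toHalf t s) := if_neg (not_or.2 ⟨h0, h1⟩)

theorem center_mem {x : MappingCone g} (hx : x ∈ lower g ∩ upper g) (s : I) :
    center x s ∈ lower g ∩ upper g := by
  induction x using ind with
  | hm m => exact hx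
  | hc w t =>
    have h0 := inCyl_mem_upper.1 hx.2
    have h1 := inCyl_mem_lower.1 hx.1
    rw [center_inCyl h0 h1]
    exact ⟨inCyl_mem_lower.2 (toHalf_ne_one h1 s), inCyl_mem_upper.2 (toHalf_ne_zero h0 s)⟩

variable [TopologicalSpace W] [TopologicalSpace M]

/-- The quotient map onto the mapping cone. -/
def proj (g : W → M) : M ⊕ (W × I) → MappingCone g := Sum.elim (inTarget g) (inCyl g)

theorem isQuotientMap_proj : IsQuotientMap (proj g) := by
  have h : proj g = (Quot.mk (MappingConeRel g)) ∘ Sum.map id (Quot.mk (ConeRel W)) := by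
    ext (m | a) <;> rfl
  have h1 : IsQuotientMap (Y := Cone W) (Quot.mk (ConeRel W)) := isQuotientMap_quot_mk
  refine h ▸ IsQuotientMap.comp isQuotientMap_quot_mk ?_
  refine (isQuotientMap_iff _).2 ⟨isCoinducing_iff.2 fun s => ?_, ?_⟩
  · rw [isOpen_sum_iff, isOpen_sum_iff]
    exact and_congr_right fun _ => h1.isOpen_preimage (s := Sum.inr ⁻¹' s)
  · rintro (m | c)
    · exact ⟨Sum.inl m, rfl⟩
    · obtain ⟨a, rfl⟩ := h1.surjective c
      exact ⟨Sum.inr a, rfl⟩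

theorem continuous_proj : Continuous (proj g) := isQuotientMap_proj.continuous

theorem continuous_inTarget : Continuous (inTarget g) := continuous_proj.comp continuous_inl

theorem continuous_inCyl : Continuous (inCyl g) := continuous_proj.comp continuous_inr

theorem continuous_height : Continuous (height (g := g)) :=
  isQuotientMap_proj.continuous_iff.2 (continuous_sum_dom.2
    ⟨continuous_const, continuous_subtype_val.comp continuous_snd⟩)

/-- Continuity of a family of maps on an open part of the mapping cone. -/
theorem continuous_prod_of_isOpen {Z : Type*} [TopologicalSpace Z] {O : Set (MappingCone g)}
    (hO : IsOpen O) {F : MappingCone g → I → Z}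
    (hm : ∀ m s, inTarget g m ∈ O →
      ContinuousAt (fun p : M × I => F (inTarget g p.1) p.2) (m, s))
    (hc : ∀ w t s, inCyl g (w, t) ∈ O →
      ContinuousAt (fun p : (W × I) × I => F (inCyl g p.1) p.2) ((w, t), s)) :
    Continuous fun p : O × I => F p.1.1 p.2 := by
  -- Over an open set the projection is still a quotient map, and so is its product with the locally
  -- compact interval.
  refine (isQuotientMap_proj.restrictPreimage_isOpen hO).continuous_lift_prod_left ?_
  rw [continuous_iff_continuousAt]
  rintro ⟨⟨a, ha⟩, s⟩
  have key : ContinuousAt (fun q : (M ⊕ (W × I)) × I => F (proj g q.1) q.2) (a, s) := by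
    rcases a with m | ⟨w, t⟩
    · exact ((IsOpenEmbedding.inl.prodMap IsOpenEmbedding.id).continuousAt_iff
        (x := ((m, s) : M × I))).1 (hm m s ha)
    · exact ((IsOpenEmbedding.inr.prodMap IsOpenEmbedding.id).continuousAt_iff
        (x := (((w, t), s) : (W × I) × I))).1 (hc w t s ha)
  exact ContinuousAt.comp (f := fun q : (proj g ⁻¹' O) × I => (q.1.1, q.2)) (x := (⟨a, ha⟩, s)) key
    (by fun_prop)

theorem continuous_of_isOpen {Z : Type*} [TopologicalSpace Z] {O : Set (MappingCone g)}
    (hO : IsOpen O) {F : MappingCone g → Z}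
    (hm : ∀ m, inTarget g m ∈ O → ContinuousAt (fun m => F (inTarget g m)) m)
    (hc : ∀ a, inCyl g a ∈ O → ContinuousAt (fun a => F (inCyl g a)) a) :
    Continuous fun x : O => F x.1 := by
  have := continuous_prod_of_isOpen hO (F := fun x _ => F x)
    (fun m s h => ContinuousAt.comp (g := fun m => F (inTarget g m)) (f := Prod.fst)
      (x := (m, s)) (hm m h) continuousAt_fst)
    (fun w t s h => ContinuousAt.comp (g := fun a => F (inCyl g a)) (f := Prod.fst)
      (x := ((w, t), s)) (hc (w, t) h) continuousAt_fst)
  exact this.comp (continuous_id.prodMk (continuous_const (y := (0 : I))))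

theorem isOpen_lower : IsOpen (lower g) := isOpen_lt continuous_height continuous_const

theorem isOpen_upper : IsOpen (upper g) := isOpen_lt continuous_const continuous_height

theorem eventually_snd_ne {w : W} {t a : I} {s : I} (h : t ≠ a) :
    ∀ᶠ p : (W × I) × I in 𝓝 ((w, t), s), p.1.2 ≠ a :=
  (continuous_snd.comp continuous_fst).continuousAt.eventually_ne h

theorem continuous_push : Continuous fun p : lower g × I => push p.1.1 p.2 := by
  refine continuous_prod_of_isOpen isOpen_lower (fun m s _ => ?_) fun w t s h => ?_
  · exact (continuous_inTarget.comp continuous_fst).continuousAt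
  · have h' := inCyl_mem_lower.1 h
    have hc : Continuous fun p : (W × I) × I => inCyl g (p.1.1, σ p.2 * p.1.2) :=
      continuous_inCyl.comp (by fun_prop)
    refine hc.continuousAt.congr ?_
    filter_upwards [eventually_snd_ne h'] with p hp
    exact (push_inCyl hp _).symm

theorem continuous_contract : Continuous fun p : upper g × I => contract p.1.1 p.2 := by
  refine continuous_prod_of_isOpen isOpen_upper
    (fun m s h => absurd h (inTarget_notMem_upper m)) fun w t s h => ?_
  have h' := inCyl_mem_upper.1 h
  have hc : Continuous fun p : (W × I) × I => inCyl g (p.1.1, σ (σ p.2 * σ p.1.2)) :=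
    continuous_inCyl.comp (by fun_prop)
  refine hc.continuousAt.congr ?_
  filter_upwards [eventually_snd_ne h'] with p hp
  exact (contract_inCyl hp _).symm

theorem continuous_toHalf : Continuous fun p : I × I => toHalf p.1 p.2 :=
  Continuous.subtype_mk (by fun_prop) _

theorem continuous_center :
    Continuous fun p : (lower g ∩ upper g : Set (MappingCone g)) × I => center p.1.1 p.2 := by
  refine continuous_prod_of_isOpen (isOpen_lower.inter isOpen_upper)
    (fun m s h => absurd h.2 (inTarget_notMem_upper m)) fun w t s h => ?_
  have h0 := inCyl_mem_upper.1 h.2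
  have h1 := inCyl_mem_lower.1 h.1
  have hc : Continuous fun p : (W × I) × I => inCyl g (p.1.1, toHalf p.1.2 p.2) :=
    continuous_inCyl.comp (by have := continuous_toHalf; fun_prop)
  refine hc.continuousAt.congr ?_
  filter_upwards [eventually_snd_ne h0, eventually_snd_ne h1] with p hp hp'
  exact (center_inCyl hp hp' _).symm

end MappingCone

/-! ### Homotopy types of the two pieces and the split exact sequence of the cone -/

namespace MappingCone

open Topology unitInterval Chain

variable {W M : Type u} [TopologicalSpace W] [TopologicalSpace M] (g : C(W, M))

/-- The inclusion of the target into the complement of the cone point. -/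
def targetMap : C(M, lower g) := ⟨fun m => ⟨inTarget g m, inTarget_mem_lower m⟩,
  continuous_inTarget.subtype_mk _⟩

open Classical in
/-- The retraction onto the target, extended arbitrarily to the cone point. -/
def retractFun [Nonempty M] (x : MappingCone g) : M :=
  lift id (fun a => if a.2 = 1 then Classical.arbitrary M else g a.1)
    (fun w => by simp) (fun w w' => by simp) x

theorem retractFun_inCyl [Nonempty M] {w : W} {t : I} (ht : t ≠ 1) :
    retractFun g (inCyl g (w, t)) = g w := if_neg ht

/-- The retraction of the complement of the cone point onto the target. -/
def retract [Nonempty M] : C(lower g, M) where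
  toFun x := retractFun g x.1
  continuous_toFun := by
    refine continuous_of_isOpen isOpen_lower (fun m _ => continuous_id.continuousAt) ?_
    rintro ⟨w, t⟩ h
    have hc : Continuous fun a : W × I => g a.1 := by fun_prop
    refine hc.continuousAt.congr ?_
    filter_upwards [continuous_snd.continuousAt.eventually_ne (inCyl_mem_lower.1 h)] with a ha
    exact (retractFun_inCyl g ha).symm

theorem targetMap_comp_retract [Nonempty M] :
    ((targetMap g).comp (retract g)).Homotopic (ContinuousMap.id _) := by
  refine ContinuousMap.Homotopic.symm ⟨{
    toFun := fun p => ⟨push p.2.1 p.1, push_mem_lower p.2.2 p.1⟩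
    continuous_toFun := (continuous_push.comp continuous_swap).subtype_mk _
    map_zero_left := ?_
    map_one_left := ?_ }⟩
  · rintro ⟨x, hx⟩
    apply Subtype.ext
    change push x 0 = x
    induction x using ind with
    | hm m => rfl
    | hc w t => rw [push_inCyl (inCyl_mem_lower.1 hx), symm_zero, one_mul]
  · rintro ⟨x, hx⟩
    apply Subtype.ext
    change push x 1 = inTarget g (retractFun g x)
    induction x using ind with
    | hm m => rfl
    | hc w t =>
      rw [push_inCyl (inCyl_mem_lower.1 hx), symm_one, zero_mul, inCyl_zero,
        retractFun_inCyl g (inCyl_mem_lower.1 hx)]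

theorem retract_comp_targetMap [Nonempty M] :
    (retract g).comp (targetMap g) = ContinuousMap.id _ := rfl

theorem targetMap_bijective [Nonempty M] (n : ℤ) : Function.Bijective (H.map n (targetMap g)) :=
  H.map_bijective_of_homotopic n (g := retract g)
    (by rw [retract_comp_targetMap]) (targetMap_comp_retract g)

theorem retract_bijective [Nonempty M] (n : ℤ) : Function.Bijective (H.map n (retract g)) :=
  H.map_bijective_of_homotopic n (g := targetMap g)
    (targetMap_comp_retract g) (by rw [retract_comp_targetMap])

/-- The cone point. -/
def apex (w : W) : upper g := ⟨inCyl g (w, 1), inCyl_mem_upper.2 one_ne_zero⟩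

theorem homotopic_apex (w : W) :
    (ContinuousMap.id (upper g)).Homotopic (ContinuousMap.const _ (apex g w)) := by
  refine ⟨{
    toFun := fun p => ⟨contract p.2.1 p.1, contract_mem_upper p.2.2 p.1⟩
    continuous_toFun := (continuous_contract.comp continuous_swap).subtype_mk _
    map_zero_left := ?_
    map_one_left := ?_ }⟩
  · rintro ⟨x, hx⟩
    apply Subtype.ext
    change contract x 0 = x
    induction x using ind with
    | hm m => rfl
    | hc w t => rw [contract_inCyl (inCyl_mem_upper.1 hx), symm_zero, one_mul, symm_symm]
  · rintro ⟨x, hx⟩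
    apply Subtype.ext
    change contract x 1 = inCyl g (w, 1)
    induction x using ind with
    | hm m => exact absurd hx (inTarget_notMem_upper m)
    | hc w' t =>
      rw [contract_inCyl (inCyl_mem_upper.1 hx), symm_one, zero_mul, symm_zero, inCyl_one]

theorem isEmpty_upper [IsEmpty W] : IsEmpty (upper g) := by
  refine ⟨fun ⟨x, hx⟩ => ?_⟩
  induction x using ind with
  | hm m => exact inTarget_notMem_upper m hx
  | hc w t => exact isEmptyElim w

/-- The open cone is contractible, or empty when `W` is. Injectivity covers both cases, and the
empty one does occur: `L_{<k}` is empty for `k ≤ 0`. -/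
theorem upper_toPoint_injective (n : ℕ) : Function.Injective (H.map n (toPoint (upper g))) := by
  rcases isEmpty_or_nonempty W with h | ⟨⟨w⟩⟩
  · have := isEmpty_upper g
    have := subsingleton_H_of_isEmpty n (upper g)
    exact Function.injective_of_subsingleton _
  · exact H.map_toPoint_injective_of_homotopic n (homotopic_apex g w)

/-- The inclusion of the middle of the cylinder. -/
def middle : C(W, (lower g ∩ upper g : Set (MappingCone g))) :=
  ⟨fun w => ⟨inCyl g (w, half), inCyl_mem_lower.2 half_ne_one, inCyl_mem_upper.2 half_ne_zero⟩,
    (continuous_inCyl.comp (by fun_prop)).subtype_mk _⟩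

open Classical in
/-- The projection of the open cylinder to its base, extended arbitrarily. -/
def baseFun [Nonempty W] (x : MappingCone g) : W :=
  lift (fun _ => Classical.arbitrary W)
    (fun a => if a.2 = 0 ∨ a.2 = 1 then Classical.arbitrary W else a.1)
    (fun w => by simp) (fun w w' => by simp) x

theorem baseFun_inCyl [Nonempty W] {w : W} {t : I} (h0 : t ≠ 0) (h1 : t ≠ 1) :
    baseFun g (inCyl g (w, t)) = w := if_neg (not_or.2 ⟨h0, h1⟩)

/-- The projection of the open cylinder to its base. -/
def base [Nonempty W] : C((lower g ∩ upper g : Set (MappingCone g)), W) where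
  toFun x := baseFun g x.1
  continuous_toFun := by
    refine continuous_of_isOpen (isOpen_lower.inter isOpen_upper)
      (fun m h => absurd h.2 (inTarget_notMem_upper m)) ?_
    rintro ⟨w, t⟩ h
    refine continuous_fst.continuousAt.congr ?_
    filter_upwards [continuous_snd.continuousAt.eventually_ne (inCyl_mem_lower.1 h.1),
      continuous_snd.continuousAt.eventually_ne (inCyl_mem_upper.1 h.2)] with a ha ha'
    exact (baseFun_inCyl g ha' ha).symm

theorem base_comp_middle [Nonempty W] : (base g).comp (middle g) = ContinuousMap.id _ :=
  ContinuousMap.ext fun _ => baseFun_inCyl g half_ne_zero half_ne_one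

theorem middle_comp_base [Nonempty W] :
    ((middle g).comp (base g)).Homotopic (ContinuousMap.id _) := by
  refine ContinuousMap.Homotopic.symm ⟨{
    toFun := fun p => ⟨center p.2.1 p.1, center_mem p.2.2 p.1⟩
    continuous_toFun := (continuous_center.comp continuous_swap).subtype_mk _
    map_zero_left := ?_
    map_one_left := ?_ }⟩
  · rintro ⟨x, hx⟩
    apply Subtype.ext
    change center x 0 = x
    induction x using ind with
    | hm m => rfl
    | hc w t =>
      rw [center_inCyl (inCyl_mem_upper.1 hx.2) (inCyl_mem_lower.1 hx.1), toHalf_zero]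
  · rintro ⟨x, hx⟩
    apply Subtype.ext
    change center x 1 = inCyl g (baseFun g x, half)
    induction x using ind with
    | hm m => exact absurd hx.2 (inTarget_notMem_upper m)
    | hc w t =>
      rw [center_inCyl (inCyl_mem_upper.1 hx.2) (inCyl_mem_lower.1 hx.1), toHalf_one,
        baseFun_inCyl g (inCyl_mem_upper.1 hx.2) (inCyl_mem_lower.1 hx.1)]

theorem middle_bijective (n : ℕ) : Function.Bijective (H.map n (middle g)) := by
  rcases isEmpty_or_nonempty W with h | h
  · have := isEmpty_upper g
    have : IsEmpty (lower g ∩ upper g : Set (MappingCone g)) :=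
      ⟨fun x => isEmptyElim (⟨x.1, x.2.2⟩ : upper g)⟩
    have := subsingleton_H_of_isEmpty n W
    have := subsingleton_H_of_isEmpty n (lower g ∩ upper g : Set (MappingCone g))
    exact ⟨Function.injective_of_subsingleton _, fun y => ⟨0, Subsingleton.elim _ _⟩⟩
  · exact H.map_bijective_of_homotopic n (g := base g) (by rw [base_comp_middle])
      (middle_comp_base g)

/-- Up to homotopy equivalence, including the intersection into the complement of the cone point is
the map `g`. -/
theorem retract_interLeft_middle [Nonempty M] (n : ℤ) (x : H n W) :
    H.map n (retract g) (H.map n (interLeft (lower g) (upper g)) (H.map n (middle g) x)) =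
      H.map n g x := by
  rw [H.map_map, H.map_map]
  congr 2
  exact ContinuousMap.ext fun w => retractFun_inCyl g half_ne_one

theorem interLeft_middle_eq_zero_iff [Nonempty M] (n : ℤ) (x : H n W) :
    H.map n (interLeft (lower g) (upper g)) (H.map n (middle g) x) = 0 ↔ H.map n g x = 0 := by
  rw [← retract_interLeft_middle g, map_eq_zero_iff _ (retract_bijective g n).1]

/-- Homology of the open cone is detected on a point, and the map to the point also factors through
`lower`. So the second condition in the Mayer-Vietoris kernel is automatic, even in degree zero, and
the unreduced kernel of `g_*` appears. -/
theorem interRight_eq_zero (n : ℕ) {x : H (n : ℤ) (lower g ∩ upper g : Set (MappingCone g))}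
    (h : H.map n (interLeft (lower g) (upper g)) x = 0) :
    H.map n (interRight (lower g) (upper g)) x = 0 := by
  rw [← map_eq_zero_iff _ (upper_toPoint_injective g n), H.map_map,
    show (toPoint (upper g)).comp (interRight (lower g) (upper g)) =
      (toPoint (lower g)).comp (interLeft (lower g) (upper g)) from rfl, ← H.map_map, h, map_zero]

theorem ker_equiv [Nonempty M] (n : ℕ) : Nonempty (LinearMap.ker (H.map n g) ≃ₗ[ℝ]
    (LinearMap.ker (H.map n (interLeft (lower g) (upper g))) ⊓
      LinearMap.ker (H.map n (interRight (lower g) (upper g))) :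
      Submodule ℝ (H (n : ℤ) (lower g ∩ upper g : Set (MappingCone g))))) := by
  let e := LinearEquiv.ofBijective (H.map n (middle g)) (middle_bijective g n)
  refine ⟨e.submoduleMap (LinearMap.ker (H.map n g)) ≪≫ₗ LinearEquiv.ofEq _ _ ?_⟩
  apply le_antisymm
  · rintro _ ⟨x, hx, rfl⟩
    have h := (interLeft_middle_eq_zero_iff g n x).2 hx
    exact ⟨h, interRight_eq_zero g n h⟩
  · rintro y ⟨hy, -⟩
    obtain ⟨x, rfl⟩ := (middle_bijective g n).2 y
    exact ⟨x, (interLeft_middle_eq_zero_iff g n x).1 hy, rfl⟩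

theorem subsingleton_H_upper (n : ℕ) : Subsingleton (H ((n + 1 : ℕ) : ℤ) (upper g)) := by
  have := subsingleton_H_point.{u} (n := ((n + 1 : ℕ) : ℤ)) (by positivity)
  exact (upper_toPoint_injective g (n + 1)).subsingleton

/-- In positive degrees the open cone has no homology, so the two pieces contribute the image of
`H(M)`; by exactness, the classes killed are those coming from `W`. -/
theorem coker_equiv [Nonempty M] (n : ℕ) :
    Nonempty ((H ((n + 1 : ℕ) : ℤ) M ⧸ LinearMap.range (H.map ((n + 1 : ℕ) : ℤ) g)) ≃ₗ[ℝ]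
      LinearMap.range ((H.map ((n + 1 : ℕ) : ℤ) (incl (lower g))).coprod
        (H.map ((n + 1 : ℕ) : ℤ) (incl (upper g))))) := by
  have := subsingleton_H_upper g n
  let φ := H.map ((n + 1 : ℕ) : ℤ) (incl (lower g)) ∘ₗ H.map ((n + 1 : ℕ) : ℤ) (targetMap g)
  have hker : LinearMap.range (H.map ((n + 1 : ℕ) : ℤ) g) = LinearMap.ker φ := by
    have hmid : ∀ x, H.map ((n + 1 : ℕ) : ℤ) (targetMap g) (H.map ((n + 1 : ℕ) : ℤ) g x) =
        H.map ((n + 1 : ℕ) : ℤ) (interLeft (lower g) (upper g))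
          (H.map ((n + 1 : ℕ) : ℤ) (middle g) x) := by
      intro x
      apply (retract_bijective g _).1
      rw [retract_interLeft_middle, H.map_map, retract_comp_targetMap, H.map_id_apply]
    apply le_antisymm
    · rintro _ ⟨x, rfl⟩
      change H.map _ (incl (lower g)) (H.map _ (targetMap g) (H.map _ g x)) = 0
      rw [hmid, H.map_map, show (incl (lower g)).comp (interLeft (lower g) (upper g)) =
        (incl (upper g)).comp (interRight (lower g) (upper g)) from rfl, ← H.map_map,
        Subsingleton.elim (H.map _ (interRight (lower g) (upper g)) _) 0, map_zero]
    · intro x hx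
      obtain ⟨e, he, -⟩ := mayerVietoris_exact isOpen_lower isOpen_upper lower_union_upper
        (n := n + 1) (x := H.map _ (targetMap g) x) (y := 0)
        ((congrArg _ (map_zero _)).trans ((add_zero _).trans hx))
      obtain ⟨w, rfl⟩ := (middle_bijective g (n + 1)).2 e
      exact ⟨w, (targetMap_bijective g _).1 ((hmid w).trans he)⟩
  have hrange : LinearMap.range φ =
      LinearMap.range ((H.map ((n + 1 : ℕ) : ℤ) (incl (lower g))).coprod
        (H.map ((n + 1 : ℕ) : ℤ) (incl (upper g)))) := by
    apply le_antisymm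
    · rintro _ ⟨x, rfl⟩
      exact ⟨(H.map _ (targetMap g) x, 0), by simp [φ]⟩
    · rintro _ ⟨⟨x, y⟩, rfl⟩
      obtain ⟨m, rfl⟩ := (targetMap_bijective g _).2 x
      exact ⟨m, by simp [φ, Subsingleton.elim y 0]⟩
  exact ⟨Submodule.quotEquivOfEq _ _ hker ≪≫ₗ φ.quotKerEquivRange ≪≫ₗ LinearEquiv.ofEq _ _ hrange⟩

/-- The homology of a mapping cone in positive degrees. -/
theorem homology_equiv [Nonempty M] (n : ℕ) :
    Nonempty (H ((n + 1 : ℕ) : ℤ) (MappingCone g) ≃ₗ[ℝ]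
      (H ((n + 1 : ℕ) : ℤ) M ⧸ LinearMap.range (H.map ((n + 1 : ℕ) : ℤ) g)) ×
        LinearMap.ker (H.map n g)) := by
  obtain ⟨e⟩ := mayerVietoris_equiv (isOpen_lower (g := g)) isOpen_upper lower_union_upper n
  obtain ⟨e₁⟩ := coker_equiv g n
  obtain ⟨e₂⟩ := ker_equiv g n
  exact ⟨e ≪≫ₗ (e₁.symm.prodCongr e₂.symm)⟩

theorem pathConnectedSpace [PathConnectedSpace M] : PathConnectedSpace (MappingCone g) := by
  obtain ⟨m₀⟩ : Nonempty M := inferInstance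
  have h : ∀ x : MappingCone g, Joined (inTarget g m₀) x := by
    intro x
    induction x using ind with
    | hm m => exact (PathConnectedSpace.joined m₀ m).map continuous_inTarget
    | hc w t =>
      have h1 : Joined (inTarget g m₀) (inTarget g (g w)) :=
        (PathConnectedSpace.joined m₀ (g w)).map continuous_inTarget
      have h2 : Joined (inCyl g (w, 0)) (inCyl g (w, t)) :=
        ((isPathConnected_iff_pathConnectedSpace.1
          ((convex_Icc (0 : ℝ) 1).isPathConnected ⟨0, by simp⟩)).joined 0 t).map
          (continuous_inCyl.comp (Continuous.prodMk_right w))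
      rw [inCyl_zero] at h2
      exact h1.trans h2
  exact ⟨⟨inTarget g m₀⟩, fun x y => (h x).symm.trans (h y)⟩

end MappingCone

/-! ### The blow-up of the suspension -/

namespace Susp

variable {L : Type u}

/-- The `L`-coordinate of a point of the suspension; it is arbitrary at the poles. -/
def point (x : Susp L) : L := (Quotient.out x).1

theorem point_mk {y : L} {t : Icc (-1 : ℝ) 1} (h : mk y t ∉ poles L) : point (mk y t) = y := by
  have h1 : mk (Quotient.out (mk y t)).1 (Quotient.out (mk y t)).2 = mk y t :=
    Quotient.out_eq (mk y t)
  rcases mk_eq_mk.1 h1 with h2 | h2 | h2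
  · exact (Prod.ext_iff.1 h2).1
  · exact absurd (Or.inl h2.2) h
  · exact absurd (Or.inr h2.2) h

theorem height_mem (x : Susp L) : height x ∈ Icc (-1 : ℝ) 1 := by
  induction x using ind with | h y t => exact t.2

theorem point_tube (a : L × poles L × Ioo (0 : ℝ) 1) : point (tube a) = a.1 :=
  point_mk (tube_not_mem a)

theorem height_side_mul_abs (x : Susp L) : height (side x).1 * |height x| = height x := by
  rw [height_side]
  split_ifs with h
  · rw [abs_of_nonneg h, one_mul]
  · rw [abs_of_neg (not_le.1 h), neg_one_mul, neg_neg]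

theorem tube_side {y : L} {t : Icc (-1 : ℝ) 1} (h : 1 - |(t : ℝ)| ∈ Ioo (0 : ℝ) 1) :
    tube (y, side (mk y t), ⟨1 - |(t : ℝ)|, h⟩) = mk y t := by
  refine mk_eq_mk.2 (Or.inl (Prod.ext rfl (Subtype.ext ?_)))
  change height (side (mk y t)).1 * (1 - (1 - |(t : ℝ)|)) = t
  rw [sub_sub_cancel]
  exact height_side_mul_abs (mk y t)

theorem mk_mem_poles {y : L} {t : Icc (-1 : ℝ) 1} : mk y t ∈ poles L ↔ |(t : ℝ)| = 1 :=
  (abs_eq zero_le_one).symm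

/-- The pole of height one. -/
def north (y : L) : poles L := ⟨mk y ⟨1, by norm_num⟩, Or.inl rfl⟩

/-- The pole of height minus one. -/
def south (y : L) : poles L := ⟨mk y ⟨-1, by norm_num⟩, Or.inr rfl⟩

theorem north_ne_south (y : L) : north y ≠ south y := fun h => by
  have : (1 : ℝ) = -1 := congrArg (fun s : poles L => height s.1) h
  norm_num at this

theorem eq_north_or_south (y : L) (s : poles L) : s = north y ∨ s = south y := by
  rcases s.2 with h | h
  · exact Or.inl (pole_ext h)
  · exact Or.inr (pole_ext h)

variable [TopologicalSpace L]

/-- The height separates the poles, so they form a Hausdorff space with at most two points.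
Discreteness makes the slices of a product with `poles L` open. -/
theorem discreteTopology_poles : DiscreteTopology (poles L) := by
  have : T2Space (poles L) := T2Space.of_injective_continuous (f := fun s : poles L => height s.1)
    (fun _ _ => pole_ext) (continuous_height.comp continuous_subtype_val)
  have : Finite (poles L) := by
    rcases isEmpty_or_nonempty (poles L) with h | ⟨⟨s⟩⟩
    · infer_instance
    · have y := point s.1
      refine Set.finite_univ_iff.1 ((Set.toFinite {north y, south y}).subset fun s _ => ?_)
      exact eq_north_or_south y s
  infer_instance

theorem continuous_point : Continuous fun x : ((poles L)ᶜ : Set (Susp L)) => point x.1 := by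
  have h : Topology.IsQuotientMap fun a : L × Icc (-1 : ℝ) 1 => mk a.1 a.2 :=
    isQuotientMap_quotient_mk'
  refine (h.restrictPreimage_isOpen isClosed_poles.isOpen_compl).continuous_iff.2 ?_
  exact (continuous_fst.comp continuous_subtype_val).congr fun a => (point_mk a.2).symm

variable (L) in
/-- The blow-up of the suspension at its poles. -/
abbrev Blow : Type u := BlowUp (standardTube L)

/-! ### The blow-up as a cylinder on the link -/

namespace Blow

/-- The inclusion of the regular part. -/
def inReg (x : ((poles L)ᶜ : Set (Susp L))) : Blow L := Quot.mk _ (Sum.inl x)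

/-- The inclusion of the collar. -/
def inCollar (a : L × poles L × Ico (0 : ℝ) 1) : Blow L := Quot.mk _ (Sum.inr a)

theorem inReg_tube (c : L × poles L × Ioo (0 : ℝ) 1) : inReg ⟨tube c, tube_not_mem c⟩ =
    inCollar (c.1, c.2.1, ⟨c.2.2, Ioo_subset_Ico_self c.2.2.2⟩) :=
  Quot.sound ⟨c, rfl, rfl⟩

theorem continuous_inReg : Continuous (inReg (L := L)) := continuous_quot_mk.comp continuous_inl

theorem continuous_inCollar : Continuous (inCollar (L := L)) :=
  continuous_quot_mk.comp continuous_inr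

theorem ind {P : Blow L → Prop} (hr : ∀ y t h, P (inReg ⟨mk y t, h⟩)) (hc : ∀ a, P (inCollar a))
    (x : Blow L) : P x := by
  induction x using Quot.ind with | mk x =>
  rcases x with ⟨x, hx⟩ | a
  · induction x using Susp.ind with | h y t => exact hr y t hx
  · exact hc a

/-- The projection of the blow-up to the link. -/
def toLink : C(Blow L, L) where
  toFun := Quot.lift (Sum.elim (fun x => point x.1) fun a => a.1) (by
    rintro _ _ ⟨c, rfl, rfl⟩
    exact point_tube c)
  continuous_toFun := continuous_quot_lift _ (continuous_sum_dom.2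
    ⟨continuous_point, continuous_fst⟩)

theorem toLink_inReg {y : L} {t : Icc (-1 : ℝ) 1} (h : mk y t ∉ poles L) :
    toLink (inReg ⟨mk y t, h⟩) = y := point_mk h

theorem toLink_inCollar (a : L × poles L × Ico (0 : ℝ) 1) : toLink (inCollar a) = a.1 := rfl

/-- The height of a point of the blow-up. -/
def level : Blow L → Icc (-1 : ℝ) 1 :=
  Quot.lift (Sum.elim (fun x => ⟨height x.1, height_mem x.1⟩)
    fun a => ⟨height a.2.1.1 * (1 - a.2.2), by
      obtain ⟨y, ⟨s, hs⟩, t, h0, h1⟩ := a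
      rcases hs with hs | hs <;> simp only [hs] <;> constructor <;> linarith⟩) (by
    rintro _ _ ⟨c, rfl, rfl⟩
    rfl)

theorem continuous_level : Continuous (level (L := L)) := by
  have := continuous_height (L := L)
  refine continuous_quot_lift _ (continuous_sum_dom.2 ⟨Continuous.subtype_mk ?_ _,
    Continuous.subtype_mk ?_ _⟩)
  · fun_prop
  · fun_prop

open Classical in
/-- The inverse of `(toLink, level)`. -/
def ofProd (a : L × Icc (-1 : ℝ) 1) : Blow L :=
  if h : mk a.1 a.2 ∈ poles L then inCollar (a.1, ⟨mk a.1 a.2, h⟩, ⟨0, le_rfl, zero_lt_one⟩)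
  else inReg ⟨mk a.1 a.2, h⟩

theorem ofProd_of_notMem {y : L} {t : Icc (-1 : ℝ) 1} (h : mk y t ∉ poles L) :
    ofProd (y, t) = inReg ⟨mk y t, h⟩ := dif_neg h

theorem one_sub_abs_mem {t : Icc (-1 : ℝ) 1} (ht : (t : ℝ) ≠ 0) :
    1 - |(t : ℝ)| ∈ Ico (0 : ℝ) 1 :=
  ⟨sub_nonneg.2 (abs_le.2 t.2), sub_lt_self _ (abs_pos.2 ht)⟩

theorem ofProd_of_ne_zero {y : L} {t : Icc (-1 : ℝ) 1} (ht : (t : ℝ) ≠ 0) :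
    ofProd (y, t) = inCollar (y, side (mk y t), ⟨1 - |(t : ℝ)|, one_sub_abs_mem ht⟩) := by
  by_cases h : mk y t ∈ poles L
  · refine (dif_pos h).trans (congrArg inCollar (Prod.ext rfl (Prod.ext ?_ (Subtype.ext ?_))))
    · exact (side_pole ⟨mk y t, h⟩).symm
    · change 0 = 1 - |(t : ℝ)|
      rw [mk_mem_poles.1 h, sub_self]
  · have h1 : 0 < 1 - |(t : ℝ)| :=
      (one_sub_abs_mem ht).1.lt_of_ne fun h2 => h (mk_mem_poles.2 (sub_eq_zero.1 h2.symm).symm)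
    have h2 := tube_side (y := y) ⟨h1, (one_sub_abs_mem ht).2⟩
    rw [ofProd_of_notMem h, ← inReg_tube (y, side (mk y t), ⟨1 - |(t : ℝ)|, h1, (one_sub_abs_mem ht).2⟩)]
    exact congrArg inReg (Subtype.ext h2.symm)

/-- Near level zero the map is given by the regular part, and off level zero by the collar; the two
open sets cover the cylinder. -/
theorem continuous_ofProd : Continuous (ofProd (L := L)) := by
  rw [continuous_iff_continuousAt]
  rintro ⟨y, t⟩
  by_cases ht : (t : ℝ) = 0
  · have ho : IsOpen {a : L × Icc (-1 : ℝ) 1 | mk a.1 a.2 ∉ poles L} :=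
      isClosed_poles.isOpen_compl.preimage continuous_mk
    refine ContinuousOn.continuousAt ?_ (ho.mem_nhds (show mk y t ∉ poles L by
      rw [mk_mem_poles, ht, abs_zero]; exact zero_ne_one))
    rw [continuousOn_iff_continuous_domRestrict]
    refine (continuous_inReg.comp ((continuous_mk.comp continuous_subtype_val).subtype_mk
      fun a => a.2)).congr fun a => ?_
    exact (ofProd_of_notMem a.2).symm
  · have ho : IsOpen {a : L × Icc (-1 : ℝ) 1 | (a.2 : ℝ) ≠ 0} :=
      isOpen_ne_fun (by fun_prop) continuous_const
    refine ContinuousOn.continuousAt ?_ (ho.mem_nhds ht)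
    rw [continuousOn_iff_continuous_domRestrict]
    have hs : Continuous fun a : {a : L × Icc (-1 : ℝ) 1 | (a.2 : ℝ) ≠ 0} => side (mk a.1.1 a.1.2) :=
      continuousOn_side.comp_continuous (continuous_mk.comp continuous_subtype_val) fun a => a.2
    refine (continuous_inCollar.comp ((continuous_fst.comp continuous_subtype_val).prodMk
      (hs.prodMk (Continuous.subtype_mk (f := fun a => 1 - |(a.1.2 : ℝ)|) (by fun_prop)
        fun a => one_sub_abs_mem a.2)))).congr fun a => ?_
    exact (ofProd_of_ne_zero a.2).symm

theorem ofProd_toLink_level (x : Blow L) : ofProd (toLink x, level x) = x := by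
  induction x using ind with
  | hr y t h =>
    rw [toLink_inReg]
    exact ofProd_of_notMem h
  | hc a =>
    obtain ⟨y, s, t⟩ := a
    have ht : 0 < 1 - (t : ℝ) := sub_pos.2 t.2.2
    have hs : height s.1 = 1 ∨ height s.1 = -1 := s.2
    have h0 : (level (inCollar (y, s, t)) : ℝ) = height s.1 * (1 - t) := rfl
    have h1 : |(level (inCollar (y, s, t)) : ℝ)| = 1 - t := by
      rw [h0, abs_mul, abs_of_pos ht, (abs_eq zero_le_one).2 hs, one_mul]
    have h2 : (level (inCollar (y, s, t)) : ℝ) ≠ 0 := abs_pos.1 (h1 ▸ ht)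
    rw [toLink_inCollar, ofProd_of_ne_zero h2]
    refine congrArg inCollar (Prod.ext rfl (Prod.ext (pole_ext ?_) (Subtype.ext ?_)))
    · refine mul_right_cancel₀ ht.ne' ?_
      have := height_side_mul_abs (mk y (level (inCollar (y, s, t))))
      rwa [height_mk, h1] at this
    · change 1 - |(level (inCollar (y, s, t)) : ℝ)| = t
      rw [h1, sub_sub_cancel]

/-- The inclusion of the link as the level zero. -/
def ofLink : C(L, Blow L) := ⟨fun y => ofProd (y, ⟨0, by norm_num⟩),
  continuous_ofProd.comp (by fun_prop)⟩

theorem toLink_comp_ofLink : toLink.comp ofLink = ContinuousMap.id L := by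
  refine ContinuousMap.ext fun y => ?_
  have h : mk y ⟨0, by norm_num⟩ ∉ poles L := by
    rw [mk_mem_poles, abs_zero]; exact zero_ne_one
  exact (congrArg toLink (ofProd_of_notMem h)).trans (toLink_inReg h)

/-- In the coordinates `(toLink, level)` the homotopy shrinks the level to zero;
`ofProd_toLink_level` identifies its start with the identity. -/
theorem ofLink_comp_toLink : (ofLink.comp toLink).Homotopic (ContinuousMap.id (Blow L)) := by
  refine ContinuousMap.Homotopic.symm ⟨{
    toFun := fun p => ofProd (toLink p.2, ⟨(1 - p.1) * level p.2, ?_⟩)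
    continuous_toFun := continuous_ofProd.comp ?_
    map_zero_left := fun x => ?_
    map_one_left := fun x => ?_ }⟩
  · obtain ⟨⟨s, h0, h1⟩, x⟩ := p
    obtain ⟨h2, h3⟩ := (level x).2
    constructor <;> nlinarith
  · have := continuous_level (L := L)
    exact Continuous.prodMk (by fun_prop) (Continuous.subtype_mk (by fun_prop) _)
  · refine Eq.trans ?_ (ofProd_toLink_level x)
    refine congrArg (fun t => ofProd (toLink x, t)) (Subtype.ext ?_)
    change (1 - (0 : ℝ)) * level x = level x
    rw [sub_zero, one_mul]
  · refine congrArg (fun t => ofProd (toLink x, t)) (Subtype.ext ?_)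
    change (1 - (1 : ℝ)) * level x = 0
    rw [sub_self, zero_mul]

theorem toLink_bijective (n : ℤ) : Function.Bijective (H.map n (toLink (L := L))) :=
  H.map_bijective_of_homotopic n (g := ofLink) ofLink_comp_toLink
    (by rw [toLink_comp_ofLink])

theorem pathConnectedSpace [PathConnectedSpace L] : PathConnectedSpace (Blow L) := by
  obtain ⟨F⟩ := ofLink_comp_toLink (L := L)
  have h : ∀ x : Blow L, Joined (ofLink (toLink x)) x := fun x =>
    ⟨⟨⟨fun s => F (s, x), by fun_prop⟩, F.map_zero_left x, F.map_one_left x⟩⟩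
  obtain ⟨y⟩ : Nonempty L := inferInstance
  exact ⟨⟨ofLink y⟩, fun a b => (h a).symm.trans
    (((PathConnectedSpace.joined (toLink a) (toLink b)).map ofLink.continuous).trans (h b))⟩

/-- The gluing map `Y × poles → Blow L` of the intersection space, for a map `f : Y → L`. -/
def attach {Y : Type u} [TopologicalSpace Y] (f : C(Y, L)) : C(Y × poles L, Blow L) :=
  ⟨fun a => BlowUp.boundary (standardTube L) (f a.1, a.2), continuous_inCollar.comp (by fun_prop)⟩

theorem toLink_attach {Y : Type u} [TopologicalSpace Y] (f : C(Y, L)) (a : Y × poles L) :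
    toLink (attach f a) = f a.1 := rfl

end Blow

end Susp

/-! ### The homology of two copies of a space -/

section TwoCopies

variable {Y S : Type u} [TopologicalSpace Y] [TopologicalSpace S]

/-- The inclusion of a slice of a product. -/
def slice (Y : Type u) [TopologicalSpace Y] (s : S) : C(Y, Y × S) := ⟨fun y => (y, s), by fun_prop⟩

/-- The slice of a product over a point. -/
def sliceHomeomorph (Y : Type u) [TopologicalSpace Y] (s : S) :
    Y ≃ₜ {a : Y × S | a.2 = s} where
  toFun y := ⟨(y, s), rfl⟩
  invFun a := a.1.1
  left_inv _ := rfl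
  right_inv := by rintro ⟨⟨y, _⟩, rfl⟩; rfl
  continuous_toFun := Continuous.subtype_mk (by fun_prop) _
  continuous_invFun := by fun_prop

theorem coprod_slice_bijective [DiscreteTopology S] {s s' : S} (hne : s ≠ s')
    (hs : ∀ x, x = s ∨ x = s') (n : ℕ) :
    Function.Bijective ((H.map n (slice Y s)).coprod (H.map n (slice Y s'))) := by
  have ho : ∀ s : S, IsOpen {a : Y × S | a.2 = s} := fun s =>
    (isOpen_discrete ({s} : Set S)).preimage continuous_snd
  have h := H.coprod_bijective_of_disjoint (ho s) (ho s') (eq_univ_of_forall fun a => hs a.2)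
    (eq_empty_of_forall_notMem fun a ha => hne (ha.1.symm.trans ha.2)) n
  have key : ∀ (s : S) (x : H (n : ℤ) Y), H.map n (slice Y s) x =
      H.map n (Chain.incl {a : Y × S | a.2 = s}) (H.map n (sliceHomeomorph Y s : C(Y, _)) x) :=
    fun s x => by
      rw [H.map_map]
      rfl
  have heq : ⇑((H.map n (slice Y s)).coprod (H.map n (slice Y s'))) =
      ⇑((H.map n (Chain.incl {a : Y × S | a.2 = s})).coprod
        (H.map n (Chain.incl {a : Y × S | a.2 = s'}))) ∘
      Prod.map (H.map n (sliceHomeomorph Y s : C(Y, _)))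
        (H.map n (sliceHomeomorph Y s' : C(Y, _))) := by
    funext ⟨x, y⟩
    rw [Function.comp_apply, Prod.map_apply, LinearMap.coprod_apply, LinearMap.coprod_apply, key,
      key]
  rw [heq]
  exact h.comp ((H.map_homeomorph_bijective n (sliceHomeomorph Y s)).prodMap
    (H.map_homeomorph_bijective n (sliceHomeomorph Y s')))

variable {M L : Type u} [TopologicalSpace M] [TopologicalSpace L] {G : C(Y × S, M)} {q : C(M, L)}
  {f : C(Y, L)}

/-- After `q`, both slices of `G` become `f`, so `G` acts on pairs of classes by folding them. -/
theorem map_slice_add (hG : ∀ a, q (G a) = f a.1) (s s' : S) (n : ℤ) (x y : H n Y) :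
    H.map n q (H.map n G (H.map n (slice Y s) x + H.map n (slice Y s') y)) =
      H.map n f (x + y) := by
  have h : ∀ s : S, q.comp (G.comp (slice Y s)) = f := fun s =>
    ContinuousMap.ext fun y => hG (y, s)
  simp only [map_add, H.map_map, h]

theorem range_eq_top_of_bijective {n : ℤ} (hG : ∀ a, q (G a) = f a.1) (s : S)
    (hq : Function.Bijective (H.map n q)) (hf : Function.Bijective (H.map n f)) :
    LinearMap.range (H.map n G) = ⊤ := by
  refine LinearMap.range_eq_top.2 fun x => ?_
  obtain ⟨y, hy⟩ := hf.2 (H.map n q x)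
  refine ⟨H.map n (slice Y s) y, hq.1 ?_⟩
  have := map_slice_add hG s s n y 0
  rw [map_zero, add_zero, add_zero] at this
  rw [this, hy]

/-- On pairs the map is `(x, y) ↦ f_*(x + y)` up to isomorphism, so its kernel is the antidiagonal,
parametrized by `φ`. -/
theorem ker_equiv_of_bijective [DiscreteTopology S] {s s' : S} (hne : s ≠ s')
    (hs : ∀ x, x = s ∨ x = s') {n : ℕ} (hG : ∀ a, q (G a) = f a.1)
    (hq : Function.Bijective (H.map n q)) (hf : Function.Bijective (H.map n f)) :
    Nonempty (LinearMap.ker (H.map n G) ≃ₗ[ℝ] H (n : ℤ) L) := by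
  have hb := coprod_slice_bijective (Y := Y) hne hs n
  have hker : ∀ x y : H (n : ℤ) Y, H.map n G (H.map n (slice Y s) x + H.map n (slice Y s') y) = 0 ↔
      y = -x := fun x y => by
    rw [← map_eq_zero_iff _ hq.1, map_slice_add hG, map_eq_zero_iff _ hf.1, add_comm,
      add_eq_zero_iff_eq_neg]
  let φ : H (n : ℤ) Y →ₗ[ℝ] H (n : ℤ) (Y × S) :=
    (H.map n (slice Y s)).coprod (H.map n (slice Y s')) ∘ₗ LinearMap.id.prod (-LinearMap.id)
  have hφ : Function.Injective φ := hb.1.comp fun x y h => (Prod.ext_iff.1 h).1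
  have hr : LinearMap.range φ = LinearMap.ker (H.map n G) := by
    apply le_antisymm
    · rintro _ ⟨x, rfl⟩
      exact (hker x (-x)).2 rfl
    · intro z hz
      obtain ⟨⟨x, y⟩, rfl⟩ := hb.2 z
      obtain rfl := (hker x y).1 hz
      exact ⟨x, rfl⟩
  exact ⟨(LinearEquiv.ofInjective φ hφ ≪≫ₗ LinearEquiv.ofEq _ _ hr).symm ≪≫ₗ
    LinearEquiv.ofBijective _ hf⟩

theorem subsingleton_H_prod [DiscreteTopology S] {s s' : S} (hne : s ≠ s')
    (hs : ∀ x, x = s ∨ x = s') {n : ℕ} (hY : Subsingleton (H (n : ℤ) Y)) :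
    Subsingleton (H (n : ℤ) (Y × S)) :=
  (coprod_slice_bijective (Y := Y) hne hs n).2.subsingleton

end TwoCopies

/-! ### The intersection space of the suspension -/

section Intersection

open Susp

variable {L : Type u} [TopologicalSpace L] [PathConnectedSpace L] {k : ℤ}
  (A : MooreApproximation k L)

theorem subsingleton_coker_attach {n : ℤ} (h : n < k) :
    Subsingleton (H n (Blow L) ⧸ LinearMap.range (H.map n (Blow.attach A.map))) := by
  obtain ⟨y⟩ : Nonempty L := inferInstance
  rw [Submodule.Quotient.subsingleton_iff]
  exact range_eq_top_of_bijective (Blow.toLink_attach A.map) (north y) (Blow.toLink_bijective n)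
    (A.bijective n h)

theorem ker_attach_equiv {n : ℕ} (h : n < k) :
    Nonempty (LinearMap.ker (H.map n (Blow.attach A.map)) ≃ₗ[ℝ] H (n : ℤ) L) := by
  obtain ⟨y⟩ : Nonempty L := inferInstance
  have := discreteTopology_poles (L := L)
  exact ker_equiv_of_bijective (north_ne_south y) (eq_north_or_south y)
    (Blow.toLink_attach A.map) (Blow.toLink_bijective n) (A.bijective n h)

theorem subsingleton_H_attach {n : ℕ} (h : k ≤ n) : Subsingleton (H (n : ℤ) (A.space × poles L)) := by
  obtain ⟨y⟩ : Nonempty L := inferInstance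
  have := discreteTopology_poles (L := L)
  exact subsingleton_H_prod (north_ne_south y) (eq_north_or_south y) (A.vanishing n h)

theorem coker_attach_equiv {n : ℕ} (h : k ≤ n) :
    Nonempty ((H (n : ℤ) (Blow L) ⧸ LinearMap.range (H.map n (Blow.attach A.map))) ≃ₗ[ℝ]
      H (n : ℤ) L) := by
  have := subsingleton_H_attach A h
  have hb : LinearMap.range (H.map n (Blow.attach A.map)) = ⊥ := by
    rw [LinearMap.range_eq_bot]
    exact LinearMap.ext fun x => by rw [Subsingleton.elim x 0, map_zero, map_zero]
  exact ⟨Submodule.quotEquivOfEqBot _ hb ≪≫ₗ LinearEquiv.ofBijective _ (Blow.toLink_bijective n)⟩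

theorem pathConnectedSpace_attach : PathConnectedSpace (MappingCone (Blow.attach A.map)) :=
  have := Blow.pathConnectedSpace (L := L)
  MappingCone.pathConnectedSpace _

theorem reducedH_attach_equiv (n : ℕ) :
    Nonempty (reducedH ((n + 1 : ℕ) : ℤ) (MappingCone (Blow.attach A.map)) ≃ₗ[ℝ]
      (H ((n + 1 : ℕ) : ℤ) (Blow L) ⧸ LinearMap.range (H.map ((n + 1 : ℕ) : ℤ) (Blow.attach A.map))) ×
        LinearMap.ker (H.map n (Blow.attach A.map))) := by
  have := Blow.pathConnectedSpace (L := L)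
  obtain ⟨e⟩ := exists_equiv_reducedH_of_pos (n := ((n + 1 : ℕ) : ℤ)) (by positivity)
    (MappingCone (Blow.attach A.map))
  obtain ⟨e'⟩ := MappingCone.homology_equiv (Blow.attach A.map) n
  exact ⟨e ≪≫ₗ e'⟩

/-- The reduced homology of the intersection space of a suspension. -/
theorem reducedH_attach (j : ℤ) :
    (0 < j → j < k →
      Nonempty (reducedH j (MappingCone (Blow.attach A.map)) ≃ₗ[ℝ] H (j - 1) L)) ∧
    (j = k →
      Nonempty (reducedH j (MappingCone (Blow.attach A.map)) ≃ₗ[ℝ] reducedH j L × H (j - 1) L)) ∧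
    (¬(0 < j ∧ j < k) → j ≠ k →
      Nonempty (reducedH j (MappingCone (Blow.attach A.map)) ≃ₗ[ℝ] reducedH j L)) := by
  rcases le_or_gt j 0 with hj | hj
  -- In degrees `j ≤ 0` all groups vanish, including `H (j - 1) L`, whose degree is negative.
  · have := pathConnectedSpace_attach A
    have := subsingleton_reducedH_of_nonpos hj (MappingCone (Blow.attach A.map))
    have := subsingleton_reducedH_of_nonpos hj L
    have := subsingleton_H_of_neg (n := j - 1) (by omega) L
    exact ⟨fun h => absurd hj h.not_ge, fun _ => ⟨0⟩, fun _ _ => ⟨0⟩⟩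
  obtain ⟨n, rfl⟩ : ∃ n : ℕ, j = ((n + 1 : ℕ) : ℤ) := ⟨(j - 1).toNat, by omega⟩
  obtain ⟨e⟩ := reducedH_attach_equiv A n
  obtain ⟨eL⟩ := exists_equiv_reducedH_of_pos hj L
  rw [show ((n + 1 : ℕ) : ℤ) - 1 = n by push_cast; ring]
  refine ⟨fun _ h => ?_, fun h => ?_, fun h h' => ?_⟩
  -- For `j < k` only the kernel in degree `j - 1` survives.
  · have := subsingleton_coker_attach A h
    obtain ⟨e'⟩ := ker_attach_equiv A (n := n) (by push_cast at h; omega)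
    have := Unique.mk' (H ((n + 1 : ℕ) : ℤ) (Blow L) ⧸
      LinearMap.range (H.map ((n + 1 : ℕ) : ℤ) (Blow.attach A.map)))
    exact ⟨e ≪≫ₗ LinearEquiv.uniqueProd ≪≫ₗ e'⟩
  -- At `j = k` the degree `j` is past the cut-off but `j - 1` is not, so both terms survive.
  · obtain ⟨e'⟩ := ker_attach_equiv A (n := n) (by push_cast at h; omega)
    obtain ⟨e''⟩ := coker_attach_equiv A (n := n + 1) h.ge
    exact ⟨e ≪≫ₗ (e'' ≪≫ₗ eL.symm).prodCongr e'⟩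
  -- Since `0 < j`, this case means `k < j`; then `k ≤ j - 1` and the kernel vanishes too.
  · obtain ⟨e''⟩ := coker_attach_equiv A (n := n + 1) (by omega)
    have := subsingleton_H_attach A (n := n) (by omega)
    have := Unique.mk' (LinearMap.ker (H.map n (Blow.attach A.map)))
    exact ⟨e ≪≫ₗ LinearEquiv.prodUnique ≪≫ₗ e'' ≪≫ₗ eL.symm⟩

end Intersection

end

end HISusp

theorem theoremA1 (l : ℕ) (L : Type u) [TopologicalSpace L] [T2Space L]
    [SecondCountableTopology L] [ChartedSpace (EuclideanSpace ℝ (Fin l)) L]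
    [IsManifold (𝓡 l) ∞ L] [SimplyConnectedSpace L] (_orientation : OrientedAtlas l L)
    (p : ExtendedPerversity) (A : MooreApproximation (cutoff p l) L) (j : ℤ) :
    (0 < j → j < cutoff p l →
      Nonempty (reducedHI p l j (Susp.standardTube L) A ≃ₗ[ℝ] H (j - 1) L)) ∧
    (j = cutoff p l →
      Nonempty (reducedHI p l j (Susp.standardTube L) A ≃ₗ[ℝ] reducedH j L × H (j - 1) L)) ∧
    (¬(0 < j ∧ j < cutoff p l) → j ≠ cutoff p l →
      Nonempty (reducedHI p l j (Susp.standardTube L) A ≃ₗ[ℝ] reducedH j L)) := by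
  -- `IntersectionSpace` unfolds to the mapping cone of `Blow.attach A.map`.
  exact reducedH_attach A j
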